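/- Let $\mathcal G$ be an undirected weighted graph on $n$ vertices with symmetric, entrywise non-negative weighted adjacency matrix $W_{\mathcal G}\in\mathbb R^{n\times n}$, degree matrix $D=\mathrm{diag}(W_{\mathcal G}\mathbf 1)$ and normalized Laplacian $L=I-D^{-1/2}W_{\mathcal G}D^{-1/2}$ (with $0^{-1/2}:=0$ at vertices of degree zero). Let $L=U\Sigma U^\top$ be any eigendecomposition with $U=(u_1,\dots,u_n)$ orthogonal and $\Sigma=\mathrm{diag}(\sigma_1,\dots,\sigma_n)$, $\sigma_1\le\cdots\le\sigma_n$. Fix $\Delta t>0$ and set $A=e^{-\Delta t L}$, $\lambda_i=e^{-\Delta t\,\sigma_i}$. Let $T\ge 1$ and $1\le k\le n$ be integers. A signal $x\in\mathbb R^n$ is $k$-bandlimited if $x\in\mathrm{span}(u_1,\dots,u_k)$. Put $$f_T(\lambda)=\Big(\sum_{t=0}^{T-1}\lambda^{2t}\Big)^{1/2},\qquad \pi_{A,T}(x)=\big(x,Ax,\dots,A^{T-1}x\big)\in\mathbb R^{Tn},$$ index the coordinates of $\mathbb R^{Tn}$ by pairs $(t,i)$ with $0\le t\le T-1$, $1\le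 i\le n$, and let $\widetilde U\in\mathbb R^{Tn\times k}$ be the matrix with entries $\widetilde U_{(t,i),\ell}=\frac{\lambda_\ell^t}{f_T(\lambda_\ell)}\,u_\ell(i)$. All probability distributions below are entrywise nonzero, and samples are drawn independently with replacement. 1. (Random vertices, kept for all times.) $p$ is a probability distribution on $\{1,\dots,n\}$; $\omega_1,\dots,\omega_m$ are drawn from $p$. $S\in\mathbb R^{Tm\times Tn}$ is block diagonal with $T$ equal blocks $S^{(0)}\in\mathbb R^{m\times n}$, $S^{(0)}_{ij}=1$ if $j=\omega_i$ and $0$ otherwise; $P$ is block diagonal with $T$ blocks $\mathrm{diag}(p)$; $W=\frac1m I_{Tm}$; the coherence is $\nu=\max_{1\le i\le n}p(i)^{-1/2}\big\|\widetilde U_{\{(t,i):0\le t<T\},\,\cdot}\big\|_2$, with the spectral norm of the $T\times k$ row submatrix. 2. (Random vertices at each time.) For each $t\in\{0,\dots,T-1\}$, $p_t$ is a probability distribution on $\{1,\dots,n\}$ and $\omega_{t,1},\dots,\omega_{t,m_t}$ are drawn from $p_t$ (all samples, over all $t$, being independent). $S$ is block diagonal with blocks $S^{(t)}\in\mathbb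 R^{m_t\times n}$, $S^{(t)}_{ij}=1$ if $j=\omega_{t,i}$ and $0$ otherwise; $P$ is block diagonal with blocks $\mathrm{diag}(p_t)$; $W$ is block diagonal with blocks $\frac1{m_t}I_{m_t}$; the coherence at time $t$ is $\nu(t)=\max_{1\le i\le n}p_t(i)^{-1/2}\|\widetilde U^\top\delta_{(t,i)}\|_2$. 3. (Random space-time nodes.) $p$ is a probability distribution on the $Tn$ space-time nodes $(t,i)$; $\omega_1,\dots,\omega_m$ are drawn from $p$. $S\in\mathbb R^{m\times Tn}$, $S_{js}=1$ if $s=\omega_j$ and $0$ otherwise; $P=\mathrm{diag}(p)$; $W=\frac1m I_m$; the coherence is $\nu=\max_{s}p(s)^{-1/2}\|\widetilde U^\top\delta_s\|_2$. In each regime let $P_\Omega$ be the diagonal part of $SPS^\top$. Then for all $\delta,\epsilon\in(0,1)$: if $$m\ge\frac3{\delta^2}\,\nu^2\log\frac{2k}{\epsilon}\quad\text{(regimes 1 and 3)},\qquad m_t\ge\frac3{\delta^2}\,\nu(t)^2\log\frac{2k}{\epsilon}\ \text{ for all } t=0,\dots,T-1\quad\text{(regime 2)},$$ then with probability at least $1-\epsilon$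 it holds simultaneously for all $k$-bandlimited $x$ that $$(1-\delta)\,f_T(\lambda_k)^2\,\|x\|_2^2\ \le\ \big\|P_\Omega^{-1/2}W^{1/2}S\,\pi_{A,T}(x)\big\|_2^2\ \le\ (1+\delta)\,f_T(\lambda_1)^2\,\|x\|_2^2 .$$ -/

import Mathlib

noncomputable section

namespace DynSampling

open MeasureTheory ProbabilityTheory Matrix

/-- An undirected weighted graph on the vertices `0, …, n-1`, given by its weighted adjacency
matrix; `{i, j}` is an edge when `weight i j` is positive. -/
structure WeightedGraph (n : ℕ) where
  weight : Matrix (Fin n) (Fin n) ℝ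
  symm : weight.IsSymm
  nonneg : ∀ i j, 0 ≤ weight i j

namespace WeightedGraph

variable {n : ℕ} (G : WeightedGraph n)

def degree (i : Fin n) : ℝ := ∑ j, G.weight i j

/-- `D^{-1/2}`, with entry `0` at a vertex of degree zero. -/
def invSqrtDegree : Matrix (Fin n) (Fin n) ℝ := diagonal fun i => (√(G.degree i))⁻¹

/-- The diffusion matrix `N = D^{-1/2} W D^{-1/2}`. -/
def diffusion : Matrix (Fin n) (Fin n) ℝ := G.invSqrtDegree * G.weight * G.invSqrtDegree

/-- The normalized graph Laplacian `L = I - N`. -/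
def laplacian : Matrix (Fin n) (Fin n) ℝ := 1 - G.diffusion

/-- `A = exp(-Δt L)`. -/
def heat (Δt : ℝ) : Matrix (Fin n) (Fin n) ℝ := NormedSpace.exp (-(Δt • G.laplacian))

/-- An eigendecomposition `L = U Σ Uᵀ` with `U` orthogonal and eigenvalues in increasing order. -/
structure EigenDecomposition where
  U : Matrix (Fin n) (Fin n) ℝ
  σ : Fin n → ℝ
  orthogonal : U ∈ Matrix.orthogonalGroup (Fin n) ℝ
  monotone : Monotone σ
  decomp : G.laplacian = U * diagonal σ * Uᵀ

end WeightedGraph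

/-- The space-time nodes `(t, i)`, `t = 0, …, T-1`, `i = 0, …, n-1`, that index `ℝ^{Tn}`
(`T` blocks of length `n`). -/
abbrev SpaceTime (T n : ℕ) : Type := Σ _ : Fin T, Fin n

/-- `f_T(λ) = √(∑_{t=0}^{T-1} λ^{2t})`. -/
def fT (T : ℕ) (l : ℝ) : ℝ := √(∑ t ∈ Finset.range T, l ^ (2 * t))

/-- `π_{A,T}(x) = (x, A x, …, A^{T-1} x)`. -/
def trajectory {n : ℕ} (A : Matrix (Fin n) (Fin n) ℝ) (T : ℕ) (x : EuclideanSpace ℝ (Fin n)) :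
    EuclideanSpace ℝ (SpaceTime T n) :=
  WithLp.toLp 2 fun s => ((A ^ (s.1 : ℕ)) *ᵥ x.ofLp) s.2

section Spectral

variable {n : ℕ} {G : WeightedGraph n} (E : G.EigenDecomposition)

/-- The eigenvalues `λ_i = exp(-Δt σ_i)` of `A`, in decreasing order. -/
def eigA (Δt : ℝ) (i : Fin n) : ℝ := Real.exp (-(Δt * E.σ i))

/-- The set of `k`-bandlimited signals: the span of the first `k` columns of `U`. -/
def bandlimited {k : ℕ} (hk : k ≤ n) : Submodule ℝ (EuclideanSpace ℝ (Fin n)) :=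
  Submodule.span ℝ (Set.range fun l : Fin k => WithLp.toLp 2 fun i => E.U i (Fin.castLE hk l))

/-- The `Tn × k` matrix `Ũ_{k,T}`, whose `t`-th block has columns `(λ_l^t / f_T(λ_l)) u_l`. -/
def Utilde (Δt : ℝ) (T : ℕ) {k : ℕ} (hk : k ≤ n) : Matrix (SpaceTime T n) (Fin k) ℝ :=
  Matrix.of fun s l =>
    eigA E Δt (Fin.castLE hk l) ^ (s.1 : ℕ) / fT T (eigA E Δt (Fin.castLE hk l))
      * E.U s.2 (Fin.castLE hk l)

/-- `‖Ũ_{k,T}ᵀ δ_s‖₂` at the space-time node `s`. -/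
def nodeNorm (Δt : ℝ) (T : ℕ) {k : ℕ} (hk : k ≤ n) (s : SpaceTime T n) : ℝ :=
  ‖WithLp.toLp 2 ((Utilde E Δt T hk)ᵀ *ᵥ Pi.single s 1)‖

open scoped Matrix.Norms.L2Operator in
/-- The spectral norm of the `T × k` submatrix of `Ũ_{k,T}` whose rows are the space-time nodes
over the vertex `i`. -/
def vertexNorm (Δt : ℝ) (T : ℕ) {k : ℕ} (hk : k ≤ n) (i : Fin n) : ℝ :=
  ‖(Utilde E Δt T hk).submatrix (fun t : Fin T => (⟨t, i⟩ : SpaceTime T n)) id‖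

/-- Spectral graph weighted coherence of order `(k, T)`, regime 1. -/
def coherence₁ (Δt : ℝ) (T : ℕ) {k : ℕ} (hk : k ≤ n) (p : Fin n → ℝ) : ℝ :=
  ⨆ i : Fin n, 1 / √(p i) * vertexNorm E Δt T hk i

/-- Spectral graph weighted coherence of order `(k, T)`, regime 2 (a vector indexed by time). -/
def coherence₂ (Δt : ℝ) (T : ℕ) {k : ℕ} (hk : k ≤ n) (p : Fin T → Fin n → ℝ) (t : Fin T) : ℝ :=
  ⨆ i : Fin n, 1 / √(p t i) * nodeNorm E Δt T hk ⟨t, i⟩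

/-- Spectral graph weighted coherence of order `(k, T)`, regime 3. -/
def coherence₃ (Δt : ℝ) (T : ℕ) {k : ℕ} (hk : k ≤ n) (p : SpaceTime T n → ℝ) : ℝ :=
  ⨆ s : SpaceTime T n, 1 / √(p s) * nodeNorm E Δt T hk s

end Spectral

section Sampling

/-- An entrywise nonzero probability distribution on a finite set. -/
def IsNondegenerateDistribution {α : Type*} [Fintype α] (p : α → ℝ) : Prop :=
  (∀ a, 0 < p a) ∧ ∑ a, p a = 1

/-- The random variables `ω_j` are drawn independently, each with distribution `p_j`. -/
def IsIndependentSample {Ω ι α : Type*} [MeasurableSpace Ω] [MeasurableSpace α]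
    (μ : Measure Ω) (p : ι → α → ℝ) (ω : ι → Ω → α) : Prop :=
  (∀ j, Measurable (ω j)) ∧ iIndepFun ω μ ∧ ∀ j a, μ.real (ω j ⁻¹' {a}) = p j a

/-- The matrix with `(i, j)` entry `1` if `j = ω_i` and `0` otherwise. -/
def selection {ι α : Type*} [DecidableEq α] (ω : ι → α) : Matrix ι α ℝ :=
  Matrix.of fun i j => if j = ω i then 1 else 0

/-- The real power `M^r` of a diagonal matrix `M` with positive diagonal entries. -/
def diagPow {ι : Type*} [DecidableEq ι] (M : Matrix ι ι ℝ) (r : ℝ) : Matrix ι ι ℝ :=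
  diagonal fun i => M i i ^ r

/-- `P_Ω = diag(S P Sᵀ)`, the diagonal part of `S P Sᵀ`. -/
def sampledProb {ρ κ : Type*} [DecidableEq ρ] [Fintype κ]
    (P : Matrix κ κ ℝ) (S : Matrix ρ κ ℝ) : Matrix ρ ρ ℝ :=
  diagonal fun i => (S * P * Sᵀ) i i

/-- `P_Ω^{-1/2} W^{1/2} S`. -/
def samplingOp {ρ κ : Type*} [Fintype ρ] [DecidableEq ρ] [Fintype κ]
    (P : Matrix κ κ ℝ) (W : Matrix ρ ρ ℝ) (S : Matrix ρ κ ℝ) : Matrix ρ κ ℝ :=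
  diagPow (sampledProb P S) (-(1 / 2)) * diagPow W (1 / 2) * S

variable {n T : ℕ}

/-- Regime 1: the same sampled vertices `ω_1, …, ω_m` at all times. -/
def samplingOp₁ {m : ℕ} (p : Fin n → ℝ) (ω : Fin m → Fin n) :
    Matrix (Σ _ : Fin T, Fin m) (SpaceTime T n) ℝ :=
  samplingOp (blockDiagonal' fun _ : Fin T => diagonal p)
    ((1 / (m : ℝ)) • (1 : Matrix (Σ _ : Fin T, Fin m) (Σ _ : Fin T, Fin m) ℝ))
    (blockDiagonal' fun _ : Fin T => selection ω)

/-- Regime 2: sampled vertices `ω_{t,1}, …, ω_{t,m_t}` at time `t`. -/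
def samplingOp₂ {m : Fin T → ℕ} (p : Fin T → Fin n → ℝ) (ω : (Σ t : Fin T, Fin (m t)) → Fin n) :
    Matrix (Σ t : Fin T, Fin (m t)) (SpaceTime T n) ℝ :=
  samplingOp (blockDiagonal' fun t : Fin T => diagonal (p t))
    (blockDiagonal' fun t : Fin T => (1 / (m t : ℝ)) • (1 : Matrix (Fin (m t)) (Fin (m t)) ℝ))
    (blockDiagonal' fun t : Fin T => selection fun j : Fin (m t) => ω ⟨t, j⟩)

/-- Regime 3: sampled space-time nodes `ω_1, …, ω_m`. -/
def samplingOp₃ {m : ℕ} (p : SpaceTime T n → ℝ) (ω : Fin m → SpaceTime T n) :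
    Matrix (Fin m) (SpaceTime T n) ℝ :=
  samplingOp (diagonal p) ((1 / (m : ℝ)) • (1 : Matrix (Fin m) (Fin m) ℝ)) (selection ω)

end Sampling

/-- The two-sided bound `(1-δ) f_T(λ_k)² ‖x‖² ≤ ‖B π_{A,T}(x)‖² ≤ (1+δ) f_T(λ_1)² ‖x‖²` for all
`k`-bandlimited `x`; in the zero-based numbering of `Fin n`, `λ_k` has index `k - 1`. -/
def StablyEmbeds {n T k : ℕ} {G : WeightedGraph n} (E : G.EigenDecomposition) (Δt : ℝ)
    (hk0 : 0 < k) (hk : k ≤ n) (δ : ℝ) {ρ : Type*} [Fintype ρ]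
    (B : Matrix ρ (SpaceTime T n) ℝ) : Prop :=
  ∀ x ∈ bandlimited E hk,
    (1 - δ) * fT T (eigA E Δt ⟨k - 1, by omega⟩) ^ 2 * ‖x‖ ^ 2
        ≤ ‖WithLp.toLp 2 (B *ᵥ (trajectory (G.heat Δt) T x).ofLp)‖ ^ 2 ∧
    ‖WithLp.toLp 2 (B *ᵥ (trajectory (G.heat Δt) T x).ofLp)‖ ^ 2
        ≤ (1 + δ) * fT T (eigA E Δt ⟨0, by omega⟩) ^ 2 * ‖x‖ ^ 2

end DynSampling

end

/-! The columns of `Utilde` are orthonormal, and the trajectory of a bandlimited signal with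
coefficients `c l` is `Utilde` applied to the vector of `fT T λ_l * c l`. Since `fT T λ_l` lies
between `fT T λ_k` and `fT T λ_1`, it suffices that the sampled quadratic form on the range of
`Utilde` is within a factor `1 ± δ` of the Euclidean one (`stablyEmbeds_of_forall`). In each regime
this form is a sum of independent positive semidefinite random `k × k` matrices: rank-one Gram
matrices of the sampled nodes, or their sum over time for a sampled vertex. The weights `1 / (m p)`
make the total mean the identity, and the coherence condition bounds each summand by `δ² / (3 log
(2k/ε))`. The matrix Chernoff inequality `one_sub_le_measureReal_chernoff` then finishes.

The Chernoff inequality needs subadditivity of the trace moment generating function, which rests on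
a finite form of Lieb's theorem (`sum_trace_exp_add_le`). It is derived from joint convexity of
relative entropy (`relEntropy_le_sum`) and Klein's inequality. Joint convexity holds because
relative entropy is a renormalized integral over `t` of resolvent forms `⟨T, (L_Y + t R_T)⁻¹ T⟩`,
each of which is a maximum over `Z` of functionals linear in `(T, Y)`. -/

noncomputable section

namespace MatrixChernoff

set_option linter.unusedSectionVars false

open Matrix Filter Topology

/-! ### Spectral form of symmetric matrices and overlaps of eigenbases -/

variable {ι : Type*} [Fintype ι] [DecidableEq ι]

/-- The symmetric matrix `V diag(d) Vᵀ`. -/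
def diagForm (V : Matrix ι ι ℝ) (d : ι → ℝ) : Matrix ι ι ℝ := V * diagonal d * Vᵀ

theorem diagForm_isSymm (V : Matrix ι ι ℝ) (d : ι → ℝ) : (diagForm V d).IsSymm := by
  simp [diagForm, Matrix.IsSymm, Matrix.mul_assoc]

theorem exists_eq_diagForm {A : Matrix ι ι ℝ} (hA : A.IsSymm) :
    ∃ (V : Matrix ι ι ℝ) (d : ι → ℝ), Vᵀ * V = 1 ∧ A = diagForm V d := by
  have hH : A.IsHermitian := by
    rw [Matrix.IsHermitian, conjTranspose_eq_transpose_of_trivial]; exact hA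
  refine ⟨hH.eigenvectorUnitary, hH.eigenvalues, ?_, ?_⟩
  · have := (Matrix.mem_unitaryGroup_iff' (A := (hH.eigenvectorUnitary : Matrix ι ι ℝ))).1
      hH.eigenvectorUnitary.2
    rwa [star_eq_conjTranspose, conjTranspose_eq_transpose_of_trivial] at this
  · conv_lhs => rw [hH.spectral_theorem]
    rw [Unitary.conjStarAlgAut_apply, star_eq_conjTranspose,
      conjTranspose_eq_transpose_of_trivial]
    rfl

theorem exp_diagForm {V : Matrix ι ι ℝ} (hV : Vᵀ * V = 1) (d : ι → ℝ) :
    NormedSpace.exp (diagForm V d) = diagForm V fun i => Real.exp (d i) := by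
  have hinv : V⁻¹ = Vᵀ := Matrix.inv_eq_left_inv hV
  have hu : IsUnit V := (Matrix.isUnit_iff_isUnit_det _).2 (Matrix.isUnit_det_of_left_inverse hV)
  rw [diagForm, ← hinv, Matrix.exp_conj _ _ hu, Matrix.exp_diagonal, diagForm, hinv]
  congr 3
  funext i
  rw [Pi.coe_exp, ← Real.exp_eq_exp_ℝ]

theorem dotProduct_diagForm (V : Matrix ι ι ℝ) (d : ι → ℝ) (w : ι → ℝ) :
    w ⬝ᵥ diagForm V d *ᵥ w = ∑ j, d j * (Vᵀ *ᵥ w) j ^ 2 := by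
  rw [diagForm, ← mulVec_mulVec, ← mulVec_mulVec, dotProduct_mulVec, ← mulVec_transpose]
  simp only [dotProduct, mulVec_diagonal]
  exact Finset.sum_congr rfl fun j _ => by ring

theorem dotProduct_transpose_mulVec_self {V : Matrix ι ι ℝ} (hV : Vᵀ * V = 1) (w : ι → ℝ) :
    ∑ j, (Vᵀ *ᵥ w) j ^ 2 = w ⬝ᵥ w := by
  have h := dotProduct_diagForm V (fun _ => 1) w
  have : diagForm V (fun _ => (1 : ℝ)) = 1 := by
    simp [diagForm, mul_eq_one_comm.1 hV]
  rw [this, one_mulVec] at h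
  simpa using h.symm

theorem dotProduct_diagForm_column {V : Matrix ι ι ℝ} (hV : Vᵀ * V = 1) (d : ι → ℝ) (j : ι) :
    (fun i => V i j) ⬝ᵥ diagForm V d *ᵥ (fun i => V i j) = d j := by
  have e : (Vᵀ *ᵥ fun i => V i j) = fun l => (1 : Matrix ι ι ℝ) l j := by
    rw [← hV]; rfl
  rw [dotProduct_diagForm, e, Finset.sum_eq_single j]
  · simp
  · intro l _ hl; simp [hl]
  · simp

theorem dotProduct_column_self {V : Matrix ι ι ℝ} (hV : Vᵀ * V = 1) (j : ι) :
    (fun i => V i j) ⬝ᵥ (fun i => V i j) = 1 := by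
  have := congrFun (congrFun hV j) j
  rw [one_apply_eq] at this
  rw [← this]; rfl

theorem trace_diagForm {V : Matrix ι ι ℝ} (hV : Vᵀ * V = 1) (d : ι → ℝ) :
    (diagForm V d).trace = ∑ j, d j := by
  rw [diagForm, trace_mul_comm, ← Matrix.mul_assoc, hV, Matrix.one_mul, trace_diagonal]

/-- The squared overlaps between the columns of `U` and `V`. -/
def overlap (U V : Matrix ι ι ℝ) (i j : ι) : ℝ := (Uᵀ * V) i j ^ 2

theorem overlap_nonneg (U V : Matrix ι ι ℝ) (i j : ι) : 0 ≤ overlap U V i j := sq_nonneg _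

/-- `Uᵀ * V` is orthogonal, so its squared entries are doubly stochastic; two-basis traces thereby
reduce to averages of scalar expressions. -/
theorem sum_overlap_left {U V : Matrix ι ι ℝ} (hU : Uᵀ * U = 1) (hV : Vᵀ * V = 1) (j : ι) :
    ∑ i, overlap U V i j = 1 := by
  have h : (Uᵀ * V)ᵀ * (Uᵀ * V) = 1 := by
    rw [transpose_mul, transpose_transpose, Matrix.mul_assoc, ← Matrix.mul_assoc U,
      mul_eq_one_comm.1 hU, Matrix.one_mul, hV]
  have := congrFun (congrFun h j) j
  rw [Matrix.mul_apply, one_apply_eq] at this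
  rw [← this]
  exact Finset.sum_congr rfl fun i _ => by rw [overlap, transpose_apply, sq]

theorem sum_overlap_right {U V : Matrix ι ι ℝ} (hU : Uᵀ * U = 1) (hV : Vᵀ * V = 1) (i : ι) :
    ∑ j, overlap U V i j = 1 := by
  rw [← sum_overlap_left hV hU i]
  refine Finset.sum_congr rfl fun j _ => ?_
  rw [overlap, overlap, ← transpose_apply (Vᵀ * U), transpose_mul, transpose_transpose]

theorem trace_diagForm_mul_diagForm (U V : Matrix ι ι ℝ) (d e : ι → ℝ) :
    (diagForm V d * diagForm U e).trace = ∑ i, ∑ j, overlap U V i j * (d j * e i) := by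
  have h : (diagForm V d * diagForm U e).trace
      = ((Uᵀ * V) * diagonal d * (Uᵀ * V)ᵀ * diagonal e).trace := by
    rw [diagForm, diagForm, transpose_mul, transpose_transpose, ← Matrix.mul_assoc,
      trace_mul_comm]
    simp only [Matrix.mul_assoc]
  rw [h, Matrix.trace]
  refine Finset.sum_congr rfl fun i _ => ?_
  rw [diag_apply, mul_diagonal, Matrix.mul_apply, Finset.sum_mul]
  refine Finset.sum_congr rfl fun j _ => ?_
  rw [mul_diagonal, transpose_apply, overlap]
  ring

/-! ### Relative entropy and Klein's inequality -/

/-- The relative entropy of `V diag(τ) Vᵀ` with respect to `U diag(y) Uᵀ`. -/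
def relEntropy (V : Matrix ι ι ℝ) (τ : ι → ℝ) (U : Matrix ι ι ℝ) (y : ι → ℝ) : ℝ :=
  ∑ i, ∑ j, overlap U V i j * (τ j * (Real.log (τ j) - Real.log (y i)))

/-- Links the eigenvalue formula, suited to scalar calculus, with `tr T log T - tr T log Y`, suited
to linear manipulation in `T`. -/
theorem relEntropy_eq_trace {U V : Matrix ι ι ℝ} (hU : Uᵀ * U = 1) (hV : Vᵀ * V = 1)
    (τ y : ι → ℝ) :
    relEntropy V τ U y
      = (diagForm V τ * diagForm V fun j => Real.log (τ j)).trace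
        - (diagForm V τ * diagForm U fun i => Real.log (y i)).trace := by
  have h1 : (diagForm V τ * diagForm V fun j => Real.log (τ j)).trace
      = ∑ j, τ j * Real.log (τ j) := by
    rw [trace_diagForm_mul_diagForm]
    refine Finset.sum_congr rfl fun i _ => ?_
    rw [Finset.sum_eq_single i]
    · simp [overlap, hV]
    · intro j _ hj
      simp [overlap, hV, Matrix.one_apply_ne' hj]
    · simp
  rw [h1, trace_diagForm_mul_diagForm, relEntropy]
  simp only [mul_sub, Finset.sum_sub_distrib]
  congr 1
  rw [Finset.sum_comm]
  refine Finset.sum_congr rfl fun j _ => ?_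
  rw [← Finset.sum_mul, sum_overlap_left hU hV, one_mul]

/-- Klein's inequality. -/
theorem trace_sub_trace_le_relEntropy {U V : Matrix ι ι ℝ} (hU : Uᵀ * U = 1) (hV : Vᵀ * V = 1)
    {τ y : ι → ℝ} (hτ : ∀ j, 0 < τ j) (hy : ∀ i, 0 < y i) :
    (diagForm V τ).trace - (diagForm U y).trace ≤ relEntropy V τ U y := by
  have h1 : ∑ j, τ j = ∑ i, ∑ j, overlap U V i j * τ j := by
    rw [Finset.sum_comm]
    refine Finset.sum_congr rfl fun j _ => ?_
    rw [← Finset.sum_mul, sum_overlap_left hU hV, one_mul]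
  have h2 : ∑ i, y i = ∑ i, ∑ j, overlap U V i j * y i := by
    refine Finset.sum_congr rfl fun i _ => ?_
    rw [← Finset.sum_mul, sum_overlap_right hU hV, one_mul]
  rw [trace_diagForm hV, trace_diagForm hU, h1, h2, ← Finset.sum_sub_distrib, relEntropy]
  refine Finset.sum_le_sum fun i _ => ?_
  rw [← Finset.sum_sub_distrib]
  refine Finset.sum_le_sum fun j _ => ?_
  rw [← mul_sub]
  refine mul_le_mul_of_nonneg_left ?_ (overlap_nonneg ..)
  -- Klein's inequality becomes `log x ≤ x - 1` at `x = y i / τ j`, averaged against the overlaps.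
  have h := Real.log_le_sub_one_of_pos (div_pos (hy i) (hτ j))
  rw [Real.log_div (hy i).ne' (hτ j).ne'] at h
  have h' := mul_le_mul_of_nonneg_left h (hτ j).le
  have : τ j * (y i / τ j - 1) = y i - τ j := by
    have := (hτ j).ne'
    field_simp
  linarith

/-! ### Variational formula for the resolvent form -/

/-- The resolvent form `⟨T, (L_Y + t R_T)⁻¹ T⟩` for `T = V diag(τ) Vᵀ`, `Y = U diag(y) Uᵀ`, where
`L_Y` and `R_T` are left and right multiplication. -/
def resolventForm (t : ℝ) (V : Matrix ι ι ℝ) (τ : ι → ℝ) (U : Matrix ι ι ℝ) (y : ι → ℝ) : ℝ :=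
  ∑ i, ∑ j, overlap U V i j * (τ j ^ 2 / (y i + t * τ j))

/-- The functional whose maximum over `Z` is the resolvent form. -/
def resolventFunctional (t : ℝ) (Z T Y : Matrix ι ι ℝ) : ℝ :=
  2 * (T * Z).trace - (Zᵀ * Y * Z).trace - t * (Z * T * Zᵀ).trace

/-- Left multiplication by `Y` and right multiplication by `T` are simultaneously diagonal in these
coordinates, so the functional decouples into one concave scalar quadratic per entry of `Z`. -/
theorem resolventFunctional_conj (t : ℝ) {U V : Matrix ι ι ℝ} (hU : Uᵀ * U = 1) (hV : Vᵀ * V = 1)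
    (τ y : ι → ℝ) (Z : Matrix ι ι ℝ) :
    resolventFunctional t (U * Z * Vᵀ) (diagForm V τ) (diagForm U y)
      = ∑ i, ∑ j, (2 * ((Uᵀ * V) i j * τ j * Z i j) - (y i + t * τ j) * Z i j ^ 2) := by
  have h1 : (diagForm V τ * (U * Z * Vᵀ)).trace = ∑ i, ∑ j, (Uᵀ * V) i j * τ j * Z i j := by
    have : (diagForm V τ * (U * Z * Vᵀ)).trace = ((Uᵀ * V * diagonal τ)ᵀ * Z).trace := by
      rw [diagForm, ← Matrix.mul_assoc, trace_mul_comm]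
      simp only [transpose_mul, diagonal_transpose, transpose_transpose, ← Matrix.mul_assoc, hV,
        Matrix.one_mul]
    rw [this, Matrix.trace, Finset.sum_comm]
    refine Finset.sum_congr rfl fun j _ => ?_
    rw [diag_apply, Matrix.mul_apply]
    exact Finset.sum_congr rfl fun i _ => by rw [transpose_apply, mul_diagonal]
  have h2 : ((U * Z * Vᵀ)ᵀ * diagForm U y * (U * Z * Vᵀ)).trace
      = ∑ i, ∑ j, y i * Z i j ^ 2 := by
    have : ((U * Z * Vᵀ)ᵀ * diagForm U y * (U * Z * Vᵀ)).trace
        = (Zᵀ * (diagonal y * Z)).trace := by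
      have : (U * Z * Vᵀ)ᵀ * diagForm U y * (U * Z * Vᵀ)
          = V * (Zᵀ * ((Uᵀ * U) * diagonal y * (Uᵀ * U) * Z)) * Vᵀ := by
        simp only [diagForm, transpose_mul, transpose_transpose, Matrix.mul_assoc]
      rw [this, trace_mul_comm, ← Matrix.mul_assoc, hV, hU]
      simp
    rw [this, Matrix.trace, Finset.sum_comm]
    refine Finset.sum_congr rfl fun j _ => ?_
    rw [diag_apply, Matrix.mul_apply]
    refine Finset.sum_congr rfl fun i _ => ?_
    rw [transpose_apply, diagonal_mul]
    ring
  have h3 : ((U * Z * Vᵀ) * diagForm V τ * (U * Z * Vᵀ)ᵀ).trace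
      = ∑ i, ∑ j, τ j * Z i j ^ 2 := by
    have : ((U * Z * Vᵀ) * diagForm V τ * (U * Z * Vᵀ)ᵀ).trace
        = (Z * (diagonal τ * Zᵀ)).trace := by
      have : (U * Z * Vᵀ) * diagForm V τ * (U * Z * Vᵀ)ᵀ
          = U * (Z * ((Vᵀ * V) * diagonal τ * (Vᵀ * V) * Zᵀ)) * Uᵀ := by
        simp only [diagForm, transpose_mul, transpose_transpose, Matrix.mul_assoc]
      rw [this, trace_mul_comm, ← Matrix.mul_assoc, hV, hU]
      simp
    rw [this, Matrix.trace]
    refine Finset.sum_congr rfl fun i _ => ?_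
    rw [diag_apply, Matrix.mul_apply]
    refine Finset.sum_congr rfl fun j _ => ?_
    rw [diagonal_mul, transpose_apply]
    ring
  rw [resolventFunctional, h1, h2, h3]
  simp only [Finset.mul_sum, ← Finset.sum_sub_distrib]
  exact Finset.sum_congr rfl fun i _ => Finset.sum_congr rfl fun j _ => by ring

/-- Complete the square in each entry of `Uᵀ * Z * V`. -/
theorem resolventFunctional_le {t : ℝ} (ht : 0 ≤ t) {U V : Matrix ι ι ℝ} (hU : Uᵀ * U = 1)
    (hV : Vᵀ * V = 1) {τ y : ι → ℝ} (hτ : ∀ j, 0 < τ j) (hy : ∀ i, 0 < y i) (Z : Matrix ι ι ℝ) :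
    resolventFunctional t Z (diagForm V τ) (diagForm U y) ≤ resolventForm t V τ U y := by
  have hZ : Z = U * (Uᵀ * Z * V) * Vᵀ := by
    have : U * (Uᵀ * Z * V) * Vᵀ = (U * Uᵀ) * Z * (V * Vᵀ) := by simp only [Matrix.mul_assoc]
    rw [this, mul_eq_one_comm.1 hU, mul_eq_one_comm.1 hV, Matrix.one_mul, Matrix.mul_one]
  rw [hZ, resolventFunctional_conj t hU hV, resolventForm]
  refine Finset.sum_le_sum fun i _ => Finset.sum_le_sum fun j _ => ?_
  have hpos : 0 < y i + t * τ j := by have := hτ j; have := hy i; positivity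
  rw [overlap, ← mul_div_assoc, le_div_iff₀ hpos]
  nlinarith [sq_nonneg ((y i + t * τ j) * (Uᵀ * Z * V) i j - (Uᵀ * V) i j * τ j)]

theorem exists_resolventFunctional_eq {t : ℝ} (ht : 0 ≤ t) {U V : Matrix ι ι ℝ}
    (hU : Uᵀ * U = 1) (hV : Vᵀ * V = 1) {τ y : ι → ℝ} (hτ : ∀ j, 0 < τ j) (hy : ∀ i, 0 < y i) :
    ∃ Z, resolventFunctional t Z (diagForm V τ) (diagForm U y) = resolventForm t V τ U y := by
  -- Each entry is the vertex of the corresponding scalar parabola.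
  refine ⟨U * Matrix.of (fun i j => (Uᵀ * V) i j * τ j / (y i + t * τ j)) * Vᵀ, ?_⟩
  rw [resolventFunctional_conj t hU hV, resolventForm]
  refine Finset.sum_congr rfl fun i _ => Finset.sum_congr rfl fun j _ => ?_
  have hpos : y i + t * τ j ≠ 0 := by have := hτ j; have := hy i; positivity
  rw [overlap, of_apply]
  field_simp
  ring

theorem trace_transpose_mul_mul_le {A B : Matrix ι ι ℝ}
    (h : ∀ w, w ⬝ᵥ A *ᵥ w ≤ w ⬝ᵥ B *ᵥ w) (Z : Matrix ι ι ℝ) :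
    (Zᵀ * A * Z).trace ≤ (Zᵀ * B * Z).trace := by
  refine Finset.sum_le_sum fun j _ => ?_
  have key : ∀ C : Matrix ι ι ℝ, (Zᵀ * C * Z) j j = (fun i => Z i j) ⬝ᵥ C *ᵥ fun i => Z i j := by
    intro C
    rw [Matrix.mul_assoc, Matrix.mul_apply]
    rfl
  rw [diag_apply, diag_apply, key, key]
  exact h _

/-! ### Joint convexity of relative entropy -/

section Jensen

variable {α : Type*} [Fintype α] {p : α → ℝ} {Va Ua : α → Matrix ι ι ℝ} {τa ya : α → ι → ℝ}
  {V U : Matrix ι ι ℝ} {τ y : ι → ℝ}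

/-- Joint convexity and monotonicity of the resolvent form. -/
theorem resolventForm_le_sum {t : ℝ} (ht : 0 ≤ t) (hp : ∀ a, 0 ≤ p a)
    (hVa : ∀ a, (Va a)ᵀ * Va a = 1) (hUa : ∀ a, (Ua a)ᵀ * Ua a = 1)
    (hτa : ∀ a j, 0 < τa a j) (hya : ∀ a j, 0 < ya a j)
    (hV : Vᵀ * V = 1) (hU : Uᵀ * U = 1) (hτ : ∀ j, 0 < τ j) (hy : ∀ j, 0 < y j)
    (hT : diagForm V τ = ∑ a, p a • diagForm (Va a) (τa a))
    (hY : ∀ w, w ⬝ᵥ (∑ a, p a • diagForm (Ua a) (ya a)) *ᵥ w ≤ w ⬝ᵥ diagForm U y *ᵥ w) :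
    resolventForm t V τ U y ≤ ∑ a, p a * resolventForm t (Va a) (τa a) (Ua a) (ya a) := by
  -- Fix the maximizer for the averaged pair. At fixed `Z` the functional is linear in `(T, Y)` and
  -- decreasing in `Y`, so it splits over `a`, and each piece is at most its own maximum.
  obtain ⟨Z, hZ⟩ := exists_resolventFunctional_eq ht hU hV hτ hy
  calc resolventForm t V τ U y
      = resolventFunctional t Z (diagForm V τ) (diagForm U y) := hZ.symm
    _ ≤ resolventFunctional t Z (diagForm V τ) (∑ a, p a • diagForm (Ua a) (ya a)) := by
        have := trace_transpose_mul_mul_le hY Z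
        unfold resolventFunctional
        linarith
    _ = ∑ a, p a * resolventFunctional t Z (diagForm (Va a) (τa a)) (diagForm (Ua a) (ya a)) := by
        rw [hT]
        simp only [resolventFunctional, Matrix.sum_mul, trace_sum, smul_mul,
          Matrix.mul_smul, trace_smul, smul_eq_mul, Finset.mul_sum, ← Finset.sum_sub_distrib]
        exact Finset.sum_congr rfl fun a _ => by ring
    _ ≤ _ := Finset.sum_le_sum fun a _ => mul_le_mul_of_nonneg_left
        (resolventFunctional_le ht (hUa a) (hVa a) (hτa a) (hya a) Z) (hp a)

/-- `∫₀ʳ` of the resolvent form. -/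
def resolventIntegral (r : ℝ) (V : Matrix ι ι ℝ) (τ : ι → ℝ) (U : Matrix ι ι ℝ) (y : ι → ℝ) : ℝ :=
  ∑ i, ∑ j, overlap U V i j * (τ j * (Real.log (y i + r * τ j) - Real.log (y i)))

theorem hasDerivAt_resolventIntegral {r : ℝ} (hr : 0 ≤ r) (V U : Matrix ι ι ℝ)
    (hτ : ∀ j, 0 < τ j) (hy : ∀ j, 0 < y j) :
    HasDerivAt (fun r => resolventIntegral r V τ U y) (resolventForm r V τ U y) r := by
  unfold resolventIntegral resolventForm
  refine HasDerivAt.fun_sum fun i _ => HasDerivAt.fun_sum fun j _ => HasDerivAt.const_mul _ ?_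
  have hpos : y i + r * τ j ≠ 0 := by have := hτ j; have := hy i; positivity
  have h := ((((hasDerivAt_id r).mul_const (τ j)).const_add (y i)).log hpos).sub_const
    (Real.log (y i)) |>.const_mul (τ j)
  refine h.congr_deriv ?_
  simp only [id]
  field_simp

/-- Writing `log (y + r τ) = log r + log (y / r + τ)` shows that the divergence is exactly `log r *
tr T`, leaving `τ (log τ - log y)` in the limit. -/
theorem tendsto_resolventIntegral (hU : Uᵀ * U = 1) (hV : Vᵀ * V = 1)
    (hτ : ∀ j, 0 < τ j) (hy : ∀ j, 0 < y j) :
    Tendsto (fun r => resolventIntegral r V τ U y - Real.log r * (diagForm V τ).trace) atTop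
      (𝓝 (relEntropy V τ U y)) := by
  have key : ∀ᶠ r : ℝ in atTop,
      ∑ i, ∑ j, overlap U V i j * (τ j * (Real.log (y i * r⁻¹ + τ j) - Real.log (y i)))
        = resolventIntegral r V τ U y - Real.log r * (diagForm V τ).trace := by
    filter_upwards [eventually_gt_atTop 0] with r hr
    have h1 : Real.log r * ∑ j, τ j = ∑ i, ∑ j, overlap U V i j * (τ j * Real.log r) := by
      rw [Finset.sum_comm, Finset.mul_sum]
      refine Finset.sum_congr rfl fun j _ => ?_
      rw [← Finset.sum_mul, sum_overlap_left hU hV, one_mul, mul_comm]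
    rw [trace_diagForm hV, h1, resolventIntegral, ← Finset.sum_sub_distrib]
    refine Finset.sum_congr rfl fun i _ => ?_
    rw [← Finset.sum_sub_distrib]
    refine Finset.sum_congr rfl fun j _ => ?_
    have e : y i + r * τ j = r * (y i * r⁻¹ + τ j) := by field_simp
    have hne : y i * r⁻¹ + τ j ≠ 0 := by have := hτ j; have := hy i; positivity
    rw [e, Real.log_mul hr.ne' hne]
    ring
  refine Tendsto.congr' key ?_
  refine tendsto_finsetSum _ fun i _ => tendsto_finsetSum _ fun j _ =>
    Tendsto.const_mul _ (Tendsto.const_mul _ (Tendsto.sub_const ?_ _))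
  refine Tendsto.log ?_ (hτ j).ne'
  simpa using (tendsto_inv_atTop_zero.const_mul (y i)).add_const (τ j)

/-- Joint convexity of the relative entropy, and its monotonicity in the second argument. -/
theorem relEntropy_le_sum (hp : ∀ a, 0 ≤ p a)
    (hVa : ∀ a, (Va a)ᵀ * Va a = 1) (hUa : ∀ a, (Ua a)ᵀ * Ua a = 1)
    (hτa : ∀ a j, 0 < τa a j) (hya : ∀ a j, 0 < ya a j)
    (hV : Vᵀ * V = 1) (hU : Uᵀ * U = 1) (hτ : ∀ j, 0 < τ j) (hy : ∀ j, 0 < y j)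
    (hT : diagForm V τ = ∑ a, p a • diagForm (Va a) (τa a))
    (hY : ∀ w, w ⬝ᵥ (∑ a, p a • diagForm (Ua a) (ya a)) *ᵥ w ≤ w ⬝ᵥ diagForm U y *ᵥ w) :
    relEntropy V τ U y ≤ ∑ a, p a * relEntropy (Va a) (τa a) (Ua a) (ya a) := by
  have hd : ∀ r : ℝ, 0 ≤ r → HasDerivAt
      (fun r => ∑ a, p a * resolventIntegral r (Va a) (τa a) (Ua a) (ya a)
        - resolventIntegral r V τ U y)
      (∑ a, p a * resolventForm r (Va a) (τa a) (Ua a) (ya a) - resolventForm r V τ U y) r :=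
    fun r hr => (HasDerivAt.fun_sum fun a _ =>
      (hasDerivAt_resolventIntegral hr _ _ (hτa a) (hya a)).const_mul (p a)).sub
      (hasDerivAt_resolventIntegral hr _ _ hτ hy)
  have hmono : MonotoneOn (fun r => ∑ a, p a * resolventIntegral r (Va a) (τa a) (Ua a) (ya a)
        - resolventIntegral r V τ U y) (Set.Ici 0) := by
    refine monotoneOn_of_deriv_nonneg (convex_Ici 0)
      (fun r hr => (hd r hr).continuousAt.continuousWithinAt) ?_ ?_
    · intro r hr
      rw [interior_Ici] at hr
      exact (hd r hr.le).differentiableAt.differentiableWithinAt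
    · intro r hr
      rw [interior_Ici] at hr
      rw [(hd r hr.le).deriv, sub_nonneg]
      exact resolventForm_le_sum hr.le hp hVa hUa hτa hya hV hU hτ hy hT hY
  refine le_of_tendsto_of_tendsto (tendsto_resolventIntegral hU hV hτ hy)
    (tendsto_finsetSum _ fun a _ =>
      (tendsto_resolventIntegral (hUa a) (hVa a) (hτa a) (hya a)).const_mul (p a)) ?_
  filter_upwards [eventually_ge_atTop 0] with r hr
  -- Both integrals vanish at `r = 0`, so monotonicity of the difference gives the inequality at
  -- every `r`. The subtracted multiples of `log r` agree because `tr T = ∑ pₐ tr Tₐ`.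
  have h := hmono Set.self_mem_Ici hr hr
  simp only [resolventIntegral, zero_mul, add_zero, sub_self, mul_zero,
    Finset.sum_const_zero] at h
  rw [hT, trace_sum, Finset.mul_sum]
  simp only [trace_smul, smul_eq_mul, mul_sub, Finset.sum_sub_distrib]
  have e : ∑ a, Real.log r * (p a * (diagForm (Va a) (τa a)).trace)
      = ∑ a, p a * (Real.log r * (diagForm (Va a) (τa a)).trace) :=
    Finset.sum_congr rfl fun a _ => by ring
  rw [e]
  simp only [resolventIntegral]
  linarith

end Jensen

/-! ### Trace inequality of Lieb type -/

/-- A consequence of Lieb's concavity theorem: if `∑ pₐ exp Xₐ ≤ exp K`, then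
`∑ pₐ tr exp (H + Xₐ) ≤ tr exp (H + K)`. -/
theorem sum_trace_exp_add_le {α : Type*} [Fintype α] {p : α → ℝ} (hp : ∀ a, 0 ≤ p a)
    (hp1 : ∑ a, p a = 1) {H K : Matrix ι ι ℝ} {X : α → Matrix ι ι ℝ} (hH : H.IsSymm)
    (hK : K.IsSymm) (hX : ∀ a, (X a).IsSymm)
    (hXK : ∀ w, w ⬝ᵥ (∑ a, p a • NormedSpace.exp (X a)) *ᵥ w ≤ w ⬝ᵥ NormedSpace.exp K *ᵥ w) :
    ∑ a, p a * (NormedSpace.exp (H + X a)).trace ≤ (NormedSpace.exp (H + K)).trace := by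
  choose Ua xa hUa hXa using fun a => exists_eq_diagForm (hX a)
  choose Va ha hVa hHa using fun a => exists_eq_diagForm (hH.add (hX a))
  obtain ⟨U, κ, hU, hKU⟩ := exists_eq_diagForm hK
  obtain ⟨Q, q, hQ, hHK⟩ := exists_eq_diagForm (hH.add hK)
  have hTsymm : (∑ a, p a • diagForm (Va a) fun j => Real.exp (ha a j)).IsSymm := by
    rw [Matrix.IsSymm, transpose_sum]
    exact Finset.sum_congr rfl fun a _ => by rw [transpose_smul, diagForm_isSymm]
  obtain ⟨V, τ, hV, hT⟩ := exists_eq_diagForm hTsymm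
  -- The average `T` of the matrices `exp (H + Xₐ)` is positive definite: every one of them is, and
  -- some weight is positive.
  have hτ : ∀ j, 0 < τ j := by
    intro j
    have hnorm := dotProduct_column_self hV j
    rw [← dotProduct_diagForm_column hV τ j, ← hT, sum_mulVec, dotProduct_sum]
    have hterm : ∀ a, (fun i => V i j) ⬝ᵥ
        (p a • diagForm (Va a) fun l => Real.exp (ha a l)) *ᵥ (fun i => V i j)
        = p a * ∑ l, Real.exp (ha a l) * ((Va a)ᵀ *ᵥ fun i => V i j) l ^ 2 := by
      intro a
      rw [smul_mulVec, dotProduct_smul, dotProduct_diagForm, smul_eq_mul]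
    have hpos : ∀ a, 0 < ∑ l, Real.exp (ha a l) * ((Va a)ᵀ *ᵥ fun i => V i j) l ^ 2 := by
      intro a
      have hs := dotProduct_transpose_mulVec_self (hVa a) fun i => V i j
      rw [hnorm] at hs
      obtain ⟨l, -, hl⟩ := Finset.exists_ne_zero_of_sum_ne_zero (hs.trans_ne one_ne_zero)
      refine Finset.sum_pos' (fun l _ => by positivity) ⟨l, Finset.mem_univ _, ?_⟩
      have := (sq_nonneg (((Va a)ᵀ *ᵥ fun i => V i j) l)).lt_of_ne' hl
      positivity
    obtain ⟨b, -, hb⟩ := Finset.exists_ne_zero_of_sum_ne_zero (hp1.trans_ne one_ne_zero)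
    refine Finset.sum_pos' (fun a _ => ?_) ⟨b, Finset.mem_univ _, ?_⟩
    · rw [hterm]; exact mul_nonneg (hp a) (hpos a).le
    · rw [hterm]; exact mul_pos ((hp b).lt_of_ne' hb) (hpos b)
  have hconv := relEntropy_le_sum (Ua := Ua) (ya := fun a j => Real.exp (xa a j))
    (y := fun j => Real.exp (κ j)) hp hVa hUa (fun _ _ => Real.exp_pos _)
    (fun _ _ => Real.exp_pos _) hV hU hτ (fun _ => Real.exp_pos _) hT.symm (by
      intro w
      have := hXK w
      rw [hKU, exp_diagForm hU] at this
      convert this using 6 with a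
      rw [hXa a, exp_diagForm (hUa a)])
  -- With `Tₐ = exp (H + Xₐ)` and `Yₐ = exp Xₐ` the `Xₐ` cancel, leaving a quantity linear in `Tₐ`.
  -- Convexity therefore yields `tr T log T ≤ tr T (H + K)`.
  have hent : ∀ a, relEntropy (Va a) (fun j => Real.exp (ha a j)) (Ua a)
      (fun j => Real.exp (xa a j)) = ((diagForm (Va a) fun j => Real.exp (ha a j)) * H).trace := by
    intro a
    rw [relEntropy_eq_trace (hUa a) (hVa a)]
    simp only [Real.log_exp]
    rw [← hHa a, ← hXa a, ← trace_sub, ← Matrix.mul_sub, add_sub_cancel_right]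
  have hsum : ∑ a, p a * relEntropy (Va a) (fun j => Real.exp (ha a j)) (Ua a)
      (fun j => Real.exp (xa a j)) = (diagForm V τ * H).trace := by
    rw [← hT, Matrix.sum_mul, trace_sum]
    refine Finset.sum_congr rfl fun a _ => ?_
    rw [hent, smul_mul, trace_smul, smul_eq_mul]
  -- Klein against `exp (H + K)` bounds `tr T - tr exp (H + K)` by `tr T log T - tr T (H + K)`,
  -- which is nonpositive by the convexity bound.
  have hklein := trace_sub_trace_le_relEntropy hQ hV hτ (fun j => Real.exp_pos (q j))
  rw [relEntropy_eq_trace hQ hV] at hklein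
  rw [hsum, relEntropy_eq_trace hU hV] at hconv
  simp only [Real.log_exp] at hklein hconv
  rw [← hHK, Matrix.mul_add, trace_add, ← exp_diagForm hQ, ← hHK] at hklein
  rw [← hKU] at hconv
  have hlhs : ∑ a, p a * (NormedSpace.exp (H + X a)).trace = (diagForm V τ).trace := by
    rw [← hT, trace_sum]
    refine Finset.sum_congr rfl fun a _ => ?_
    rw [hHa a, exp_diagForm (hVa a), trace_smul, smul_eq_mul]
  rw [hlhs]
  linarith

end MatrixChernoff

end

/-! ### Matrix Laplace transform method -/

noncomputable section

namespace MatrixChernoff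

set_option linter.unusedSectionVars false

open Matrix MeasureTheory ProbabilityTheory

variable {ι : Type*} [Fintype ι] [DecidableEq ι]

theorem smul_diagForm (c : ℝ) (V : Matrix ι ι ℝ) (d : ι → ℝ) :
    c • diagForm V d = diagForm V fun j => c * d j := by
  have : diagonal (fun j => c * d j) = c • diagonal d := by
    rw [← diagonal_smul]; rfl
  rw [diagForm, diagForm, this, Matrix.mul_smul, Matrix.smul_mul]

/-- The chord bound for the convex function `d ↦ exp (θ d)` on `[0, R]`. -/
theorem exp_mul_le_chord {R d : ℝ} (hR : 0 < R) (hd0 : 0 ≤ d) (hdR : d ≤ R) (θ : ℝ) :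
    Real.exp (θ * d) ≤ 1 + (Real.exp (θ * R) - 1) / R * d := by
  have h := convexOn_exp.2 (Set.mem_univ (0 : ℝ)) (Set.mem_univ (θ * R))
    (sub_nonneg.2 ((div_le_one hR).2 hdR)) (div_nonneg hd0 hR.le) (sub_add_cancel 1 (d / R))
  simp only [smul_eq_mul, mul_zero, zero_add, Real.exp_zero, mul_one] at h
  have e : d / R * (θ * R) = θ * d := by field_simp
  rw [e] at h
  refine h.trans (le_of_eq ?_)
  field_simp
  ring

/-- The eigenvalues of `X` lie in `[0, R]`, so the scalar chord bound applies to each of them. -/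
theorem dotProduct_exp_smul_le {X : Matrix ι ι ℝ} (hX : X.IsSymm) {R : ℝ} (hR : 0 < R)
    (h0 : ∀ w, 0 ≤ w ⬝ᵥ X *ᵥ w) (hXR : ∀ w, w ⬝ᵥ X *ᵥ w ≤ R * (w ⬝ᵥ w)) (θ : ℝ) (w : ι → ℝ) :
    w ⬝ᵥ NormedSpace.exp (θ • X) *ᵥ w
      ≤ w ⬝ᵥ w + (Real.exp (θ * R) - 1) / R * (w ⬝ᵥ X *ᵥ w) := by
  obtain ⟨V, d, hV, rfl⟩ := exists_eq_diagForm hX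
  rw [smul_diagForm, exp_diagForm hV, dotProduct_diagForm, dotProduct_diagForm,
    ← dotProduct_transpose_mulVec_self hV, Finset.mul_sum, ← Finset.sum_add_distrib]
  refine Finset.sum_le_sum fun j _ => ?_
  have hd0 := h0 fun i => V i j
  have hdR := hXR fun i => V i j
  rw [dotProduct_diagForm_column hV] at hd0 hdR
  rw [dotProduct_column_self hV, mul_one] at hdR
  have := mul_le_mul_of_nonneg_right (exp_mul_le_chord hR hd0 hdR θ) (sq_nonneg ((Vᵀ *ᵥ w) j))
  refine this.trans (le_of_eq (by ring))

theorem le_dotProduct_exp {K : Matrix ι ι ℝ} (hK : K.IsSymm) (w : ι → ℝ) :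
    w ⬝ᵥ w + w ⬝ᵥ K *ᵥ w ≤ w ⬝ᵥ NormedSpace.exp K *ᵥ w := by
  obtain ⟨V, d, hV, rfl⟩ := exists_eq_diagForm hK
  rw [exp_diagForm hV, dotProduct_diagForm, dotProduct_diagForm,
    ← dotProduct_transpose_mulVec_self hV, ← Finset.sum_add_distrib]
  refine Finset.sum_le_sum fun j _ => ?_
  have := mul_le_mul_of_nonneg_right (Real.add_one_le_exp (d j)) (sq_nonneg ((Vᵀ *ᵥ w) j))
  linarith

/-- Some eigenvalue of `B` is at least `c`, and the trace of the exponential dominates each of its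
terms. This is the matrix substitute for Markov's exponential bound. -/
theorem exp_le_trace_exp {B : Matrix ι ι ℝ} (hB : B.IsSymm) {c : ℝ} {w : ι → ℝ}
    (h : c * (w ⬝ᵥ w) < w ⬝ᵥ B *ᵥ w) : Real.exp c ≤ (NormedSpace.exp B).trace := by
  obtain ⟨V, d, hV, rfl⟩ := exists_eq_diagForm hB
  rw [dotProduct_diagForm, ← dotProduct_transpose_mulVec_self hV, Finset.mul_sum] at h
  obtain ⟨j, -, hj⟩ := Finset.exists_lt_of_sum_lt h
  have hcd : c ≤ d j := by
    by_contra! hlt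
    exact absurd hj (not_lt.2 (mul_le_mul_of_nonneg_right hlt.le (sq_nonneg _)))
  rw [exp_diagForm hV, trace_diagForm hV]
  exact (Real.exp_le_exp.2 hcd).trans
    (Finset.single_le_sum (f := fun j => Real.exp (d j)) (fun _ _ => (Real.exp_pos _).le)
      (Finset.mem_univ j))

theorem trace_exp_nonneg {B : Matrix ι ι ℝ} (hB : B.IsSymm) : 0 ≤ (NormedSpace.exp B).trace := by
  obtain ⟨V, d, hV, rfl⟩ := exists_eq_diagForm hB
  rw [exp_diagForm hV, trace_diagForm hV]
  exact Finset.sum_nonneg fun _ _ => (Real.exp_pos _).le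

theorem trace_exp_smul_one (g : ℝ) :
    (NormedSpace.exp (g • (1 : Matrix ι ι ℝ))).trace = Fintype.card ι * Real.exp g := by
  have h : g • (1 : Matrix ι ι ℝ) = diagForm 1 fun _ => g := by
    rw [diagForm, Matrix.one_mul, transpose_one, Matrix.mul_one, smul_one_eq_diagonal]
  rw [h, exp_diagForm (by simp), trace_diagForm (by simp)]
  simp

theorem isSymm_sum {β : Type*} (s : Finset β) {X : β → Matrix ι ι ℝ} (h : ∀ b, (X b).IsSymm) :
    (∑ b ∈ s, X b).IsSymm := by
  rw [Matrix.IsSymm, transpose_sum]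
  exact Finset.sum_congr rfl fun b _ => h b

/-- With `g = (exp (θ R) - 1) / R`, the chord bound and `1 + K ≤ exp K` give `∑ pₐ exp (θ Xₐ) ≤ 1 +
g ∑ pₐ Xₐ ≤ exp (g ∑ pₐ Xₐ)` in the Loewner order, which is the hypothesis of the Lieb-type
inequality. No matrix logarithm of the moment generating function is needed. -/
theorem sum_trace_exp_add_smul_le {α : Type*} [Fintype α] {p : α → ℝ} (hp : ∀ a, 0 ≤ p a)
    (hp1 : ∑ a, p a = 1) {H : Matrix ι ι ℝ} {X : α → Matrix ι ι ℝ} (hH : H.IsSymm)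
    (hX : ∀ a, (X a).IsSymm) {R : ℝ} (hR : 0 < R) (h0 : ∀ a w, 0 ≤ w ⬝ᵥ X a *ᵥ w)
    (hXR : ∀ a w, w ⬝ᵥ X a *ᵥ w ≤ R * (w ⬝ᵥ w)) (θ : ℝ) :
    ∑ a, p a * (NormedSpace.exp (H + θ • X a)).trace
      ≤ (NormedSpace.exp (H + ((Real.exp (θ * R) - 1) / R) • ∑ a, p a • X a)).trace := by
  have hM : (((Real.exp (θ * R) - 1) / R) • ∑ a, p a • X a).IsSymm :=
    (isSymm_sum _ fun a => (hX a).smul (p a)).smul _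
  refine sum_trace_exp_add_le hp hp1 hH hM (fun a => (hX a).smul θ) fun w => ?_
  refine le_trans ?_ (le_dotProduct_exp hM w)
  have e : w ⬝ᵥ w = ∑ a, p a * (w ⬝ᵥ w) := by rw [← Finset.sum_mul, hp1, one_mul]
  rw [smul_mulVec, dotProduct_smul, sum_mulVec, dotProduct_sum, sum_mulVec, dotProduct_sum, e,
    smul_eq_mul, Finset.mul_sum, ← Finset.sum_add_distrib]
  refine Finset.sum_le_sum fun a _ => ?_
  rw [smul_mulVec, dotProduct_smul, smul_mulVec, dotProduct_smul, smul_eq_mul, smul_eq_mul]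
  have := mul_le_mul_of_nonneg_left (dotProduct_exp_smul_le (hX a) hR (h0 a) (hXR a) θ w) (hp a)
  linarith

/-! ### Independent summands as a product distribution -/

section Product

variable {J α : Type*} [Fintype J] [DecidableEq J] [Fintype α] {p : J → α → ℝ}

theorem sum_prod_eq_one (hp1 : ∀ j, ∑ a, p j a = 1) : ∑ f : J → α, ∏ j, p j (f j) = 1 := by
  rw [← Fintype.prod_sum]
  simp [hp1]

/-- Under a product distribution, a coordinate may be drawn anew. -/
theorem sum_prod_mul_eq_sum_update (hp1 : ∀ j, ∑ a, p j a = 1) (F : (J → α) → ℝ) (i : J) :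
    ∑ f : J → α, (∏ j, p j (f j)) * F f
      = ∑ f : J → α, (∏ j, p j (f j)) * ∑ b, p i b * F (Function.update f i b) := by
  have hw : ∀ (f : J → α) (b : α),
      (∏ j, p j (Function.update f i b j)) * p i (f i) = (∏ j, p j (f j)) * p i b := by
    intro f b
    rw [← Finset.mul_prod_erase _ _ (Finset.mem_univ i),
      ← Finset.mul_prod_erase _ (fun j => p j (f j)) (Finset.mem_univ i), Function.update_self]
    have : ∏ j ∈ Finset.univ.erase i, p j (Function.update f i b j)
        = ∏ j ∈ Finset.univ.erase i, p j (f j) :=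
      Finset.prod_congr rfl fun j hj => by rw [Function.update_of_ne (Finset.ne_of_mem_erase hj)]
    rw [this]
    ring
  -- Exchanging the old value at `i` with the fresh draw `b` is an involution that preserves the
  -- joint weight.
  have hinv : Function.Involutive
      fun x : (J → α) × α => ((Function.update x.1 i x.2, x.1 i) : (J → α) × α) := by
    rintro ⟨f, b⟩
    simp
  calc ∑ f : J → α, (∏ j, p j (f j)) * F f
      = ∑ x : (J → α) × α, (∏ j, p j (x.1 j)) * p i x.2 * F x.1 := by
        rw [Fintype.sum_prod_type]
        refine Finset.sum_congr rfl fun f _ => ?_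
        simp only
        rw [← Finset.sum_mul, ← Finset.mul_sum, hp1, mul_one]
    _ = ∑ x : (J → α) × α, (∏ j, p j (x.1 j)) * p i x.2 * F (Function.update x.1 i x.2) := by
        rw [← Equiv.sum_comp hinv.toPerm]
        refine Finset.sum_congr rfl fun x _ => ?_
        simp only [Function.Involutive.coe_toPerm]
        rw [hw]
    _ = _ := by
        rw [Fintype.sum_prod_type]
        refine Finset.sum_congr rfl fun f _ => ?_
        rw [Finset.mul_sum]
        exact Finset.sum_congr rfl fun b _ => by ring

variable {X : J → α → Matrix ι ι ℝ} {R : ℝ}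

/-- The master bound on the trace moment generating function of a sum of independent
matrices. -/
theorem sum_prod_mul_trace_exp_le (hp : ∀ j a, 0 ≤ p j a) (hp1 : ∀ j, ∑ a, p j a = 1)
    (hX : ∀ j a, (X j a).IsSymm) (hR : 0 < R) (h0 : ∀ j a w, 0 ≤ w ⬝ᵥ X j a *ᵥ w)
    (hXR : ∀ j a w, w ⬝ᵥ X j a *ᵥ w ≤ R * (w ⬝ᵥ w)) (θ : ℝ) (s : Finset J) :
    ∀ H : Matrix ι ι ℝ, H.IsSymm →
      ∑ f : J → α, (∏ j, p j (f j)) * (NormedSpace.exp (H + θ • ∑ j ∈ s, X j (f j))).trace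
        ≤ (NormedSpace.exp
            (H + ((Real.exp (θ * R) - 1) / R) • ∑ j ∈ s, ∑ a, p j a • X j a)).trace := by
  induction s using Finset.induction_on with
  | empty =>
    intro H _
    simp only [Finset.sum_empty, smul_zero, add_zero]
    rw [← Finset.sum_mul, sum_prod_eq_one hp1, one_mul]
  | insert i s hi ih =>
    intro H hH
    have hM : (((Real.exp (θ * R) - 1) / R) • ∑ a, p i a • X i a).IsSymm :=
      (isSymm_sum _ fun a => (hX i a).smul (p i a)).smul _
    rw [sum_prod_mul_eq_sum_update hp1 _ i]
    calc ∑ f : J → α, (∏ j, p j (f j)) * ∑ b, p i b * (NormedSpace.exp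
            (H + θ • ∑ j ∈ insert i s, X j (Function.update f i b j))).trace
        ≤ ∑ f : J → α, (∏ j, p j (f j)) * (NormedSpace.exp
              (H + ((Real.exp (θ * R) - 1) / R) • ∑ a, p i a • X i a
                + θ • ∑ j ∈ s, X j (f j))).trace := by
          refine Finset.sum_le_sum fun f _ => mul_le_mul_of_nonneg_left ?_
            (Finset.prod_nonneg fun j _ => hp j _)
          -- Redraw coordinate `i` with the others frozen inside the deterministic part. The
          -- resulting mean term is then absorbed into `H`, which is why the induction is over all
          -- `H`.
          have h := sum_trace_exp_add_smul_le (hp i) (hp1 i)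
            (hH.add ((isSymm_sum s fun j => hX j (f j)).smul θ)) (hX i) hR (h0 i) (hXR i) θ
          rw [add_right_comm H] at h
          refine le_of_eq_of_le (Finset.sum_congr rfl fun b _ => ?_) h
          have e : ∑ j ∈ s, X j (Function.update f i b j) = ∑ j ∈ s, X j (f j) :=
            Finset.sum_congr rfl fun j hj => by
              rw [Function.update_of_ne (ne_of_mem_of_not_mem hj hi)]
          rw [Finset.sum_insert hi, Function.update_self, e, smul_add, ← add_assoc,
            add_right_comm]
      _ ≤ _ := by
          refine (ih _ (hH.add hM)).trans (le_of_eq ?_)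
          rw [Finset.sum_insert hi, smul_add, add_assoc]

/-- The Laplace transform bound on the extreme eigenvalues of a sum of independent matrices. -/
theorem sum_filter_prod_le (hp : ∀ j a, 0 ≤ p j a) (hp1 : ∀ j, ∑ a, p j a = 1)
    (hX : ∀ j a, (X j a).IsSymm) (hR : 0 < R) (h0 : ∀ j a w, 0 ≤ w ⬝ᵥ X j a *ᵥ w)
    (hXR : ∀ j a w, w ⬝ᵥ X j a *ᵥ w ≤ R * (w ⬝ᵥ w)) (hM : ∑ j, ∑ a, p j a • X j a = 1)
    (θ c : ℝ) (s : Finset (J → α))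
    (hs : ∀ f ∈ s, ∃ w, c * (w ⬝ᵥ w) < θ * (w ⬝ᵥ (∑ j, X j (f j)) *ᵥ w)) :
    ∑ f ∈ s, ∏ j, p j (f j) ≤ Fintype.card ι * Real.exp ((Real.exp (θ * R) - 1) / R - c) := by
  have hmaster := sum_prod_mul_trace_exp_le hp hp1 hX hR h0 hXR θ Finset.univ 0 isSymm_zero
  simp only [zero_add] at hmaster
  -- Mean `1` turns the master bound into the exponential of a scalar matrix, whose trace
  -- contributes the dimension factor.
  rw [hM, trace_exp_smul_one] at hmaster
  have hsymm : ∀ f : J → α, (θ • ∑ j, X j (f j)).IsSymm := fun f =>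
    (isSymm_sum _ fun j => hX j (f j)).smul θ
  have hw : ∀ f : J → α, 0 ≤ ∏ j, p j (f j) := fun f => Finset.prod_nonneg fun j _ => hp j _
  have hmarkov : (∑ f ∈ s, ∏ j, p j (f j)) * Real.exp c
      ≤ ∑ f : J → α, (∏ j, p j (f j)) * (NormedSpace.exp (θ • ∑ j, X j (f j))).trace := by
    rw [Finset.sum_mul]
    refine (Finset.sum_le_sum fun f hf => ?_).trans
      (Finset.sum_le_sum_of_subset_of_nonneg (Finset.subset_univ s) fun f _ _ =>
        mul_nonneg (hw f) (trace_exp_nonneg (hsymm f)))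
    obtain ⟨w, hlt⟩ := hs f hf
    refine mul_le_mul_of_nonneg_left (exp_le_trace_exp (hsymm f) (w := w) ?_) (hw f)
    rwa [smul_mulVec, dotProduct_smul, smul_eq_mul]
  rw [Real.exp_sub, ← mul_div_assoc, le_div_iff₀ (Real.exp_pos c)]
  exact hmarkov.trans hmaster

end Product

/-! ### Scalar exponents and the matrix Chernoff inequality -/

/-- From `log (1 + δ) ≥ 2δ / (δ + 2)` the exponent is at most `-δ² / (δ + 2)`, and `δ + 2 ≤ 3`. -/
theorem sub_mul_log_one_add_le {δ : ℝ} (h0 : 0 < δ) (h1 : δ < 1) :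
    δ - (1 + δ) * Real.log (1 + δ) ≤ -(δ ^ 2 / 3) := by
  have h := mul_le_mul_of_nonneg_left (Real.le_log_one_add_of_nonneg h0.le)
    (by linarith : 0 ≤ 1 + δ)
  have e : (1 + δ) * (2 * δ / (δ + 2)) = δ + δ ^ 2 / (δ + 2) := by
    field_simp
    ring
  have : δ ^ 2 / 3 ≤ δ ^ 2 / (δ + 2) := by gcongr; linarith
  linarith

/-- Applying `u ≤ sinh u` to `u = -log (1 - δ)` gives the stronger bound `-δ² / 2`. -/
theorem neg_sub_mul_log_one_sub_le {δ : ℝ} (h0 : 0 < δ) (h1 : δ < 1) :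
    -δ - (1 - δ) * Real.log (1 - δ) ≤ -(δ ^ 2 / 3) := by
  have hpos : 0 < 1 - δ := by linarith
  have h : -Real.log (1 - δ) ≤ ((1 - δ)⁻¹ - (1 - δ)) / 2 := by
    have hs := Real.sinh_log (inv_pos.2 hpos)
    rw [inv_inv, Real.log_inv] at hs
    rw [← hs, Real.self_le_sinh_iff]
    have := Real.log_nonpos hpos.le (by linarith)
    linarith
  have h' := mul_le_mul_of_nonneg_left h hpos.le
  have e : (1 - δ) * (((1 - δ)⁻¹ - (1 - δ)) / 2) = δ - δ ^ 2 / 2 := by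
    field_simp
    ring
  nlinarith [sq_nonneg δ]

/-- **Matrix Chernoff inequality** for a sum of independent positive semidefinite matrices with
mean `1`. -/
theorem one_sub_le_measureReal_chernoff [Nonempty ι] {J α Ω : Type*} [Fintype J] [Fintype α]
    [MeasurableSpace α] [MeasurableSingletonClass α] [MeasurableSpace Ω] {μ : Measure Ω}
    [IsProbabilityMeasure μ] {p : J → α → ℝ} {ω : J → Ω → α}
    (hp : ∀ j, DynSampling.IsNondegenerateDistribution (p j))
    (hω : DynSampling.IsIndependentSample μ p ω) {X : J → α → Matrix ι ι ℝ}
    {δ ε : ℝ} (hδ0 : 0 < δ) (hδ1 : δ < 1) (hε0 : 0 < ε) (hε1 : ε < 1)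
    (hX : ∀ j a, (X j a).IsSymm) (h0 : ∀ j a w, 0 ≤ w ⬝ᵥ X j a *ᵥ w)
    (hXR : ∀ j a w,
      w ⬝ᵥ X j a *ᵥ w ≤ δ ^ 2 / (3 * Real.log (2 * Fintype.card ι / ε)) * (w ⬝ᵥ w))
    (hM : ∑ j, ∑ a, p j a • X j a = 1) :
    1 - ε ≤ μ.real {z | ∀ w : ι → ℝ, (1 - δ) * (w ⬝ᵥ w) ≤ w ⬝ᵥ (∑ j, X j (ω j z)) *ᵥ w ∧
      w ⬝ᵥ (∑ j, X j (ω j z)) *ᵥ w ≤ (1 + δ) * (w ⬝ᵥ w)} := by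
  classical
  set k : ℝ := (Fintype.card ι : ℝ) with hkdef
  have hk : 1 ≤ k := by rw [hkdef]; exact_mod_cast Fintype.card_pos
  have hratio : 1 < 2 * k / ε := by rw [lt_div_iff₀ hε0]; linarith
  have hlog : 0 < Real.log (2 * k / ε) := Real.log_pos hratio
  set R : ℝ := δ ^ 2 / (3 * Real.log (2 * k / ε)) with hRdef
  have hR : 0 < R := by positivity
  have hp0 : ∀ j a, 0 ≤ p j a := fun j a => ((hp j).1 a).le
  have hp1 : ∀ j, ∑ a, p j a = 1 := fun j => (hp j).2
  -- The choice of `R` makes each tail at most `ε / 2`; this is the source of `2k` in the logarithm.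
  have hexp : k * Real.exp (-(δ ^ 2 / 3) / R) = ε / 2 := by
    have e : -(δ ^ 2 / 3) / R = -Real.log (2 * k / ε) := by
      rw [hRdef]; field_simp
    rw [e, Real.exp_neg, Real.exp_log (by linarith)]
    field_simp
  let good : (J → α) → Prop := fun f => ∀ w : ι → ℝ,
    (1 - δ) * (w ⬝ᵥ w) ≤ w ⬝ᵥ (∑ j, X j (f j)) *ᵥ w ∧
      w ⬝ᵥ (∑ j, X j (f j)) *ᵥ w ≤ (1 + δ) * (w ⬝ᵥ w)
  let hi : Finset (J → α) := Finset.univ.filter fun f => ∃ w : ι → ℝ,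
    (1 + δ) * (w ⬝ᵥ w) < w ⬝ᵥ (∑ j, X j (f j)) *ᵥ w
  let lo : Finset (J → α) := Finset.univ.filter fun f => ∃ w : ι → ℝ,
    w ⬝ᵥ (∑ j, X j (f j)) *ᵥ w < (1 - δ) * (w ⬝ᵥ w)
  have hhi : ∑ f ∈ hi, ∏ j, p j (f j) ≤ ε / 2 := by
    have hl : 0 < Real.log (1 + δ) := Real.log_pos (by linarith)
    -- The optimal `θ` satisfies `exp (θ R) = 1 + δ`; the lower tail uses the negative `θ` with `exp
    -- (θ R) = 1 - δ`.
    refine (sum_filter_prod_le hp0 hp1 hX hR h0 hXR hM (Real.log (1 + δ) / R)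
      (Real.log (1 + δ) / R * (1 + δ)) hi fun f hf => ?_).trans ?_
    · obtain ⟨w, hw⟩ := (Finset.mem_filter.1 hf).2
      refine ⟨w, ?_⟩
      rw [mul_assoc]
      exact mul_lt_mul_of_pos_left hw (by positivity)
    · rw [← hexp, div_mul_cancel₀ _ hR.ne', Real.exp_log (by linarith)]
      refine mul_le_mul_of_nonneg_left (Real.exp_le_exp.2 ?_) (by positivity)
      have := div_le_div_of_nonneg_right (sub_mul_log_one_add_le hδ0 hδ1) hR.le
      refine le_trans (le_of_eq ?_) this
      ring
  have hlo : ∑ f ∈ lo, ∏ j, p j (f j) ≤ ε / 2 := by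
    have hl : Real.log (1 - δ) < 0 := Real.log_neg (by linarith) (by linarith)
    refine (sum_filter_prod_le hp0 hp1 hX hR h0 hXR hM (Real.log (1 - δ) / R)
      (Real.log (1 - δ) / R * (1 - δ)) lo fun f hf => ?_).trans ?_
    · obtain ⟨w, hw⟩ := (Finset.mem_filter.1 hf).2
      refine ⟨w, ?_⟩
      rw [mul_assoc]
      exact mul_lt_mul_of_neg_left hw (div_neg_of_neg_of_pos hl hR)
    · rw [← hexp, div_mul_cancel₀ _ hR.ne', Real.exp_log (by linarith)]
      refine mul_le_mul_of_nonneg_left (Real.exp_le_exp.2 ?_) (by positivity)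
      have := div_le_div_of_nonneg_right (neg_sub_mul_log_one_sub_le hδ0 hδ1) hR.le
      refine le_trans (le_of_eq ?_) this
      ring
  have hgood : 1 - ε ≤ ∑ f : J → α with good f, ∏ j, p j (f j) := by
    have hsplit := Finset.sum_filter_add_sum_filter_not Finset.univ good
      fun f : J → α => ∏ j, p j (f j)
    rw [sum_prod_eq_one hp1] at hsplit
    have hsub : (Finset.univ.filter fun f => ¬ good f) ⊆ lo ∪ hi := by
      intro f hf
      have hf' := (Finset.mem_filter.1 hf).2
      simp only [good, not_forall, not_and_or, not_le] at hf'
      obtain ⟨w, hw | hw⟩ := hf'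
      · exact Finset.mem_union_left _ (Finset.mem_filter.2 ⟨Finset.mem_univ _, w, hw⟩)
      · exact Finset.mem_union_right _ (Finset.mem_filter.2 ⟨Finset.mem_univ _, w, hw⟩)
    have hw : ∀ f : J → α, 0 ≤ ∏ j, p j (f j) := fun f => Finset.prod_nonneg fun j _ => hp0 j _
    have hbad := Finset.sum_le_sum_of_subset_of_nonneg hsub fun f _ _ => hw f
    have hunion := Finset.sum_union_inter (s₁ := lo) (s₂ := hi) (f := fun f => ∏ j, p j (f j))
    have hinter := Finset.sum_nonneg fun f (_ : f ∈ lo ∩ hi) => hw f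
    linarith
  have hatom : ∀ f : J → α, μ.real (⋂ j, ω j ⁻¹' {f j}) = ∏ j, p j (f j) := by
    intro f
    have h := hω.2.1.measure_inter_preimage_eq_mul Finset.univ (sets := fun j => {f j})
      fun j _ => measurableSet_singleton _
    simp only [Finset.mem_univ, Set.iInter_true] at h
    rw [measureReal_def, h, ENNReal.toReal_prod]
    exact Finset.prod_congr rfl fun j _ => hω.2.2 j (f j)
  -- The sample takes finitely many values, so the event is a finite disjoint union of atoms with
  -- product probabilities.
  have hset : {z | good fun j => ω j z}
      = ⋃ f ∈ Finset.univ.filter good, ⋂ j, ω j ⁻¹' {f j} := by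
    ext z
    simp only [Set.mem_ofPred_eq, Set.mem_iUnion, Finset.mem_filter, Finset.mem_univ, true_and,
      Set.mem_iInter, Set.mem_preimage, Set.mem_singleton_iff, exists_prop]
    constructor
    · exact fun h => ⟨_, h, fun _ => rfl⟩
    · rintro ⟨f, hf, h⟩
      rwa [funext h]
  change 1 - ε ≤ μ.real {z | good fun j => ω j z}
  rw [hset, measureReal_biUnion_finset]
  · simpa only [hatom] using hgood
  · intro f _ g _ hfg
    refine Set.disjoint_left.2 fun z hf hg => hfg ?_
    rw [Set.mem_iInter] at hf hg
    exact funext fun j => (hf j).symm.trans (hg j)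
  · exact fun f _ => MeasurableSet.iInter fun j => hω.1 j (measurableSet_singleton _)

end MatrixChernoff

end

noncomputable section

namespace DynSampling

open MeasureTheory ProbabilityTheory Matrix MatrixChernoff

/-! ### Trajectories of bandlimited signals -/

section Spectral

theorem fT_sq (T : ℕ) (l : ℝ) : fT T l ^ 2 = ∑ t ∈ Finset.range T, l ^ (2 * t) :=
  Real.sq_sqrt (Finset.sum_nonneg fun t _ => by rw [pow_mul]; positivity)

theorem fT_pos {T : ℕ} (hT : 0 < T) {l : ℝ} (hl : 0 < l) : 0 < fT T l :=
  Real.sqrt_pos.2 (Finset.sum_pos (fun t _ => by positivity) ⟨0, Finset.mem_range.2 hT⟩)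

theorem fT_sq_mono (T : ℕ) {l l' : ℝ} (hl : 0 ≤ l) (h : l ≤ l') : fT T l ^ 2 ≤ fT T l' ^ 2 := by
  rw [fT_sq, fT_sq]
  exact Finset.sum_le_sum fun t _ => pow_le_pow_left₀ hl h _

variable {n : ℕ} {G : WeightedGraph n} (E : G.EigenDecomposition) (Δt : ℝ)

theorem eigA_pos (i : Fin n) : 0 < eigA E Δt i := Real.exp_pos _

theorem eigA_antitone (hΔt : 0 < Δt) : Antitone (eigA E Δt) := fun _ _ hij =>
  Real.exp_le_exp.2 (neg_le_neg (mul_le_mul_of_nonneg_left (E.monotone hij) hΔt.le))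

theorem EigenDecomposition.transpose_mul_self : E.Uᵀ * E.U = 1 :=
  (Matrix.mem_orthogonalGroup_iff' (Fin n) ℝ).1 E.orthogonal

theorem heat_eq_diagForm : G.heat Δt = diagForm E.U (eigA E Δt) := by
  have h : -(Δt • G.laplacian) = diagForm E.U fun i => -(Δt * E.σ i) := by
    have : G.laplacian = diagForm E.U E.σ := E.decomp
    rw [this, ← neg_smul, smul_diagForm]
    congr 1
    funext i
    ring
  rw [WeightedGraph.heat, h, exp_diagForm (EigenDecomposition.transpose_mul_self E)]
  rfl

theorem heat_pow_mul (t : ℕ) :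
    G.heat Δt ^ t * E.U = E.U * diagonal fun i => eigA E Δt i ^ t := by
  induction t with
  | zero => simp
  | succ t ih =>
    rw [pow_succ, Matrix.mul_assoc, heat_eq_diagForm E, diagForm, Matrix.mul_assoc _ E.Uᵀ,
      EigenDecomposition.transpose_mul_self E, Matrix.mul_one]
    rw [← diagForm, ← heat_eq_diagForm E, ← Matrix.mul_assoc, ih, Matrix.mul_assoc,
      diagonal_mul_diagonal]
    simp only [pow_succ]

variable (T : ℕ) {k : ℕ} (hk : k ≤ n)

/-- Inner products of columns factor into a time part and a vertex part. Orthogonality of `E.U`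
kills the off-diagonal terms, and `fT` is the norm of the time profile `(λ^t)`. -/
theorem Utilde_transpose_mul_self (hT : 0 < T) :
    (Utilde E Δt T hk)ᵀ * Utilde E Δt T hk = 1 := by
  ext l l'
  have horth : ∑ i, E.U i (Fin.castLE hk l) * E.U i (Fin.castLE hk l')
      = (1 : Matrix (Fin n) (Fin n) ℝ) (Fin.castLE hk l) (Fin.castLE hk l') := by
    rw [← EigenDecomposition.transpose_mul_self E, Matrix.mul_apply]
    rfl
  set a := eigA E Δt (Fin.castLE hk l) with ha
  set b := eigA E Δt (Fin.castLE hk l') with hb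
  have h : ((Utilde E Δt T hk)ᵀ * Utilde E Δt T hk) l l'
      = (∑ t : Fin T, a ^ (t : ℕ) / fT T a * (b ^ (t : ℕ) / fT T b))
        * ∑ i, E.U i (Fin.castLE hk l) * E.U i (Fin.castLE hk l') := by
    rw [Matrix.mul_apply, Fintype.sum_sigma, Finset.sum_mul]
    refine Finset.sum_congr rfl fun t _ => ?_
    rw [Finset.mul_sum]
    refine Finset.sum_congr rfl fun i _ => ?_
    simp only [transpose_apply, Utilde, of_apply]
    ring
  rw [h, horth]
  by_cases hll : l = l'
  · subst hll
    have hpos : fT T a ≠ 0 := (fT_pos hT (eigA_pos E Δt _)).ne'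
    rw [one_apply_eq, one_apply_eq, mul_one]
    have : ∀ t : Fin T, a ^ (t : ℕ) / fT T a * (b ^ (t : ℕ) / fT T b)
        = a ^ (2 * (t : ℕ)) / fT T a ^ 2 := by
      intro t
      rw [hb, ← ha, pow_mul', div_mul_div_comm, sq, sq]
    rw [Finset.sum_congr rfl fun t _ => this t, ← Finset.sum_div, fT_sq,
      Fin.sum_univ_eq_sum_range fun t => a ^ (2 * t), ← fT_sq, div_self (pow_ne_zero 2 hpos)]
  · rw [one_apply_ne hll, one_apply_ne fun h => hll (Fin.castLE_injective hk h), mul_zero]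

theorem exists_coeff_of_mem_bandlimited (hT : 0 < T) {x : EuclideanSpace ℝ (Fin n)}
    (hx : x ∈ bandlimited E hk) :
    ∃ c : Fin k → ℝ, ‖x‖ ^ 2 = ∑ l, c l ^ 2 ∧
      (trajectory (G.heat Δt) T x).ofLp
        = Utilde E Δt T hk *ᵥ fun l => fT T (eigA E Δt (Fin.castLE hk l)) * c l := by
  obtain ⟨c, rfl⟩ := (Submodule.mem_span_range_iff_exists_fun ℝ).1 hx
  set Uk : Matrix (Fin n) (Fin k) ℝ := E.U.submatrix id (Fin.castLE hk) with hUk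
  have hx' : (∑ l, c l • (WithLp.toLp 2 fun i => E.U i (Fin.castLE hk l) :
      EuclideanSpace ℝ (Fin n))) = WithLp.toLp 2 (Uk *ᵥ c) := by
    ext i
    simp [Uk, mulVec, dotProduct, mul_comm]
  rw [hx']
  refine ⟨c, ?_, ?_⟩
  · have horth : Ukᵀ * Uk = 1 := by
      have : Ukᵀ * Uk = (E.Uᵀ * E.U).submatrix (Fin.castLE hk) (Fin.castLE hk) := by
        rw [hUk, transpose_submatrix]
        exact submatrix_mul_equiv _ _ _ (Equiv.refl _) _
      rw [this, EigenDecomposition.transpose_mul_self E, submatrix_one _ (Fin.castLE_injective hk)]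
    rw [EuclideanSpace.norm_sq_eq]
    have : (Uk *ᵥ c) ⬝ᵥ (Uk *ᵥ c) = c ⬝ᵥ c := by
      rw [dotProduct_mulVec, vecMul_mulVec, horth, vecMul_one]
    simpa [dotProduct, sq] using this
  · funext s
    have hcol : ∀ l, (G.heat Δt ^ (s.1 : ℕ) * Uk) s.2 l
        = E.U s.2 (Fin.castLE hk l) * eigA E Δt (Fin.castLE hk l) ^ (s.1 : ℕ) := by
      intro l
      have := congrFun (congrFun (heat_pow_mul E Δt s.1) s.2) (Fin.castLE hk l)
      rw [mul_diagonal] at this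
      rw [← this]
      rfl
    simp only [trajectory]
    rw [mulVec_mulVec, mulVec, dotProduct, mulVec, dotProduct]
    refine Finset.sum_congr rfl fun l _ => ?_
    have hpos : fT T (eigA E Δt (Fin.castLE hk l)) ≠ 0 := (fT_pos hT (eigA_pos E Δt _)).ne'
    rw [hcol, Utilde, of_apply]
    field_simp

/-- A two-sided bound on the range of `Ũ` gives the two-sided bound on trajectories. -/
theorem stablyEmbeds_of_forall (hT : 0 < T) (hk0 : 0 < k) (hΔt : 0 < Δt) {δ : ℝ} (hδ0 : 0 < δ)
    (hδ1 : δ < 1) {ρ : Type*} [Fintype ρ] {B : Matrix ρ (SpaceTime T n) ℝ}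
    (h : ∀ w : Fin k → ℝ,
      (1 - δ) * (w ⬝ᵥ w) ≤ ‖WithLp.toLp 2 (B *ᵥ (Utilde E Δt T hk *ᵥ w))‖ ^ 2 ∧
      ‖WithLp.toLp 2 (B *ᵥ (Utilde E Δt T hk *ᵥ w))‖ ^ 2 ≤ (1 + δ) * (w ⬝ᵥ w)) :
    StablyEmbeds E Δt hk0 hk δ B := by
  intro x hx
  obtain ⟨c, hc, htraj⟩ := exists_coeff_of_mem_bandlimited E Δt T hk hT hx
  rw [hc, htraj]
  obtain ⟨hlo, hhi⟩ := h fun l => fT T (eigA E Δt (Fin.castLE hk l)) * c l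
  have hdot : (fun l => fT T (eigA E Δt (Fin.castLE hk l)) * c l) ⬝ᵥ
      (fun l => fT T (eigA E Δt (Fin.castLE hk l)) * c l)
      = ∑ l, fT T (eigA E Δt (Fin.castLE hk l)) ^ 2 * c l ^ 2 :=
    Finset.sum_congr rfl fun l _ => by ring
  rw [hdot] at hlo hhi
  constructor
  -- Termwise comparison: `λ` decreases with the index and `fT` is monotone, so index `k - 1` is the
  -- worst case below and index `0` above.
  · refine le_trans ?_ hlo
    rw [mul_assoc]
    refine mul_le_mul_of_nonneg_left ?_ (by linarith)
    rw [Finset.mul_sum]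
    refine Finset.sum_le_sum fun l _ => ?_
    refine mul_le_mul_of_nonneg_right (fT_sq_mono T (eigA_pos E Δt _).le
      (eigA_antitone E Δt hΔt ?_)) (sq_nonneg _)
    have := l.2
    rw [Fin.le_def, Fin.val_castLE]
    simp only
    omega
  · refine hhi.trans ?_
    rw [mul_assoc]
    refine mul_le_mul_of_nonneg_left ?_ (by linarith)
    rw [Finset.mul_sum]
    refine Finset.sum_le_sum fun l _ => ?_
    refine mul_le_mul_of_nonneg_right (fT_sq_mono T (eigA_pos E Δt _).le
      (eigA_antitone E Δt hΔt ?_)) (sq_nonneg _)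
    exact Nat.zero_le _

/-- The rank-one Gram matrix `Ũᵀ δ_s δ_sᵀ Ũ` of a space-time node. -/
def nodeGram (s : SpaceTime T n) : Matrix (Fin k) (Fin k) ℝ :=
  vecMulVec (Utilde E Δt T hk s) (Utilde E Δt T hk s)

theorem nodeGram_isSymm (s : SpaceTime T n) : (nodeGram E Δt T hk s).IsSymm := by
  ext l l'
  simp [nodeGram, vecMulVec_apply, mul_comm]

theorem dotProduct_nodeGram (s : SpaceTime T n) (w : Fin k → ℝ) :
    w ⬝ᵥ nodeGram E Δt T hk s *ᵥ w = (Utilde E Δt T hk *ᵥ w) s ^ 2 := by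
  rw [nodeGram, vecMulVec_mulVec, dotProduct_smul, dotProduct_comm w, sq]
  rfl

/-- The sum over all nodes is `Utildeᵀ * Utilde`; this supplies the mean-`1` hypothesis of the
Chernoff inequality. -/
theorem sum_nodeGram (hT : 0 < T) : ∑ s, nodeGram E Δt T hk s = 1 := by
  rw [← Utilde_transpose_mul_self E Δt T hk hT]
  ext l l'
  rw [Matrix.sum_apply, Matrix.mul_apply]
  rfl

theorem nodeNorm_nonneg (s : SpaceTime T n) : 0 ≤ nodeNorm E Δt T hk s := norm_nonneg _

theorem nodeNorm_sq (s : SpaceTime T n) :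
    nodeNorm E Δt T hk s ^ 2 = ∑ l, Utilde E Δt T hk s l ^ 2 := by
  rw [nodeNorm, mulVec_single_one, EuclideanSpace.norm_sq_eq]
  simp

theorem sq_Utilde_mulVec_le (s : SpaceTime T n) (w : Fin k → ℝ) :
    (Utilde E Δt T hk *ᵥ w) s ^ 2 ≤ nodeNorm E Δt T hk s ^ 2 * (w ⬝ᵥ w) := by
  have := Finset.sum_mul_sq_le_sq_mul_sq Finset.univ (Utilde E Δt T hk s) w
  rw [nodeNorm_sq]
  simpa only [mulVec, dotProduct, sq] using this

open scoped Matrix.Norms.L2Operator in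
theorem vertexNorm_nonneg (i : Fin n) : 0 ≤ vertexNorm E Δt T hk i := norm_nonneg _

open scoped Matrix.Norms.L2Operator in
theorem sum_sq_Utilde_mulVec_le (i : Fin n) (w : Fin k → ℝ) :
    ∑ t : Fin T, (Utilde E Δt T hk *ᵥ w) ⟨t, i⟩ ^ 2 ≤ vertexNorm E Δt T hk i ^ 2 * (w ⬝ᵥ w) := by
  have h := Matrix.l2_opNorm_mulVec ((Utilde E Δt T hk).submatrix
    (fun t : Fin T => (⟨t, i⟩ : SpaceTime T n)) id) (WithLp.toLp 2 w)
  have h2 := pow_le_pow_left₀ (norm_nonneg _) h 2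
  rw [mul_pow, EuclideanSpace.norm_sq_eq, EuclideanSpace.norm_sq_eq (WithLp.toLp 2 w)] at h2
  have e : w ⬝ᵥ w = ∑ l, ‖(WithLp.toLp 2 w : EuclideanSpace ℝ (Fin k)) l‖ ^ 2 := by
    simp [dotProduct, sq]
  rw [e]
  refine le_trans (le_of_eq ?_) h2
  refine Finset.sum_congr rfl fun t _ => ?_
  rw [Real.norm_eq_abs, sq_abs]
  rfl

end Spectral

/-! ### Sampled norms as weighted sums over drawn nodes -/

section Sampling

theorem selection_mulVec {ι α : Type*} [Fintype α] [DecidableEq α] (s : ι → α) (v : α → ℝ) :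
    selection s *ᵥ v = v ∘ s := by
  funext r
  simp [mulVec, dotProduct, selection]

theorem norm_sq_samplingOp_mulVec {ρ κ : Type*} [Fintype ρ] [DecidableEq ρ] [Fintype κ]
    [DecidableEq κ] {q : κ → ℝ} (hq : ∀ a, 0 < q a) {W : Matrix ρ ρ ℝ} (hW : ∀ r, 0 ≤ W r r)
    (s : ρ → κ) (v : κ → ℝ) :
    ‖WithLp.toLp 2 (samplingOp (diagonal q) W (selection s) *ᵥ v)‖ ^ 2
      = ∑ r, W r r / q (s r) * v (s r) ^ 2 := by
  rw [EuclideanSpace.norm_sq_eq]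
  refine Finset.sum_congr rfl fun r _ => ?_
  have hP : (selection s * diagonal q * (selection s)ᵀ) r r = q (s r) := by
    rw [Matrix.mul_apply]
    simp [selection]
  have hr : (samplingOp (diagonal q) W (selection s) *ᵥ v) r
      = q (s r) ^ (-(1 / 2) : ℝ) * W r r ^ (1 / 2 : ℝ) * v (s r) := by
    rw [samplingOp, ← mulVec_mulVec, selection_mulVec, diagPow, diagPow, diagonal_mul_diagonal,
      mulVec_diagonal, sampledProb, diagonal_apply_eq, hP]
    rfl
  rw [Real.norm_eq_abs, sq_abs]
  change (samplingOp (diagonal q) W (selection s) *ᵥ v) r ^ 2 = _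
  rw [hr, Real.rpow_neg (hq _).le, ← Real.sqrt_eq_rpow, ← Real.sqrt_eq_rpow, mul_pow, mul_pow,
    inv_pow, Real.sq_sqrt (hq _).le, Real.sq_sqrt (hW r)]
  ring

/-- A block diagonal of selections is itself a selection of space-time nodes, so one norm formula
serves all regimes. -/
theorem blockDiagonal'_selection {T n : ℕ} {m : Fin T → ℕ} (ω : ∀ t, Fin (m t) → Fin n) :
    (blockDiagonal' fun t => selection (ω t))
      = selection fun r : Σ t, Fin (m t) => (⟨r.1, ω r.1 r.2⟩ : SpaceTime T n) := by
  ext ⟨t, j⟩ ⟨t', i⟩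
  by_cases h : t = t'
  · subst h
    rw [blockDiagonal'_apply_eq]
    simp [selection]
  · rw [blockDiagonal'_apply_ne _ _ _ h]
    have : ¬ ((⟨t', i⟩ : SpaceTime T n) = ⟨t, ω t j⟩) := fun e => h (congrArg Sigma.fst e).symm
    simp only [selection, of_apply, if_neg this]

variable {n T : ℕ}

theorem norm_sq_samplingOp₁_mulVec {m : ℕ} {p : Fin n → ℝ} (hp : ∀ i, 0 < p i)
    (ω : Fin m → Fin n) (v : SpaceTime T n → ℝ) :
    ‖WithLp.toLp 2 (samplingOp₁ p ω *ᵥ v)‖ ^ 2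
      = ∑ j, ∑ t : Fin T, 1 / (m : ℝ) / p (ω j) * v ⟨t, ω j⟩ ^ 2 := by
  rw [samplingOp₁, blockDiagonal'_diagonal, blockDiagonal'_selection (m := fun _ => m)
    (fun _ => ω), norm_sq_samplingOp_mulVec (q := fun s : SpaceTime T n => p s.2) (fun s => hp s.2),
    Fintype.sum_sigma, Finset.sum_comm]
  · simp
  · intro r
    simp

theorem norm_sq_samplingOp₂_mulVec {m : Fin T → ℕ} {p : Fin T → Fin n → ℝ}
    (hp : ∀ t i, 0 < p t i) (ω : (Σ t : Fin T, Fin (m t)) → Fin n) (v : SpaceTime T n → ℝ) :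
    ‖WithLp.toLp 2 (samplingOp₂ p ω *ᵥ v)‖ ^ 2
      = ∑ r : Σ t : Fin T, Fin (m t), 1 / (m r.1 : ℝ) / p r.1 (ω r) * v ⟨r.1, ω r⟩ ^ 2 := by
  rw [samplingOp₂, blockDiagonal'_diagonal, blockDiagonal'_selection fun t j => ω ⟨t, j⟩,
    norm_sq_samplingOp_mulVec (q := fun s : SpaceTime T n => p s.1 s.2) (fun s => hp s.1 s.2)]
  · refine Finset.sum_congr rfl fun r _ => ?_
    rw [show r = ⟨r.1, r.2⟩ from rfl, blockDiagonal'_apply_eq]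
    simp
  · rintro ⟨t, j⟩
    rw [blockDiagonal'_apply_eq]
    simp

theorem norm_sq_samplingOp₃_mulVec {m : ℕ} {p : SpaceTime T n → ℝ} (hp : ∀ s, 0 < p s)
    (ω : Fin m → SpaceTime T n) (v : SpaceTime T n → ℝ) :
    ‖WithLp.toLp 2 (samplingOp₃ p ω *ᵥ v)‖ ^ 2
      = ∑ j, 1 / (m : ℝ) / p (ω j) * v (ω j) ^ 2 := by
  rw [samplingOp₃, norm_sq_samplingOp_mulVec hp]
  · simp
  · intro r
    simp

theorem measurableSingletonClass_spaceTime : MeasurableSingletonClass (SpaceTime T n) := by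
  refine ⟨fun s => ?_⟩
  refine MeasurableSpace.measurableSet_iInf.2 fun t => ?_
  change MeasurableSet (Sigma.mk t ⁻¹' {s})
  exact MeasurableSet.of_discrete

/-- Turns the sample-size condition into the uniform bound on a single summand required by Chernoff.
-/
theorem weight_mul_sq_le {δ L ν N q M : ℝ} (hδ : 0 < δ) (hL : 0 < L) (hN : 0 ≤ N) (hq : 0 < q)
    (hM0 : 0 ≤ M) (hν : 1 / √q * N ≤ ν) (hM : 3 / δ ^ 2 * ν ^ 2 * L ≤ M) :
    1 / M / q * N ^ 2 ≤ δ ^ 2 / (3 * L) := by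
  -- For `M = 0` the convention `1 / 0 = 0` makes the left side vanish.
  rcases hM0.eq_or_lt with rfl | hMpos
  · simp only [div_zero, zero_div, zero_mul]
    positivity
  have hsq : N ^ 2 / q ≤ ν ^ 2 := by
    have := pow_le_pow_left₀ (by positivity) hν 2
    rw [mul_pow, div_pow, Real.sq_sqrt hq.le, one_pow] at this
    refine le_trans (le_of_eq ?_) this
    ring
  have h1 : ν ^ 2 ≤ M * (δ ^ 2 / (3 * L)) := by
    have e : M * (δ ^ 2 / (3 * L)) - ν ^ 2
        = (M - 3 / δ ^ 2 * ν ^ 2 * L) * (δ ^ 2 / (3 * L)) := by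
      field_simp
    have : 0 ≤ (M - 3 / δ ^ 2 * ν ^ 2 * L) * (δ ^ 2 / (3 * L)) :=
      mul_nonneg (sub_nonneg.2 hM) (by positivity)
    linarith
  have e : 1 / M / q * N ^ 2 = N ^ 2 / q / M := by field_simp
  rw [e, div_le_iff₀ hMpos, mul_comm]
  exact hsq.trans h1

/-- Handles empty samples: the condition then forces zero coherence, hence zero local norms. -/
theorem eq_zero_of_sample_size_zero {δ L ν N q : ℝ} (hδ : 0 < δ) (hL : 0 < L) (hN : 0 ≤ N)
    (hq : 0 < q) (hν : 1 / √q * N ≤ ν) (hM : 3 / δ ^ 2 * ν ^ 2 * L ≤ 0) : N = 0 := by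
  have h1 : ν ^ 2 ≤ 0 := by
    by_contra! h
    have : 0 < 3 / δ ^ 2 * ν ^ 2 * L := by positivity
    linarith
  have h2 : ν = 0 := pow_eq_zero_iff two_ne_zero |>.1 (le_antisymm h1 (sq_nonneg ν))
  rw [h2] at hν
  have hs : 0 < 1 / √q := by have := Real.sqrt_pos.2 hq; positivity
  by_contra hne
  have := mul_pos hs (hN.lt_of_ne' hne)
  linarith

theorem le_ciSup_of_finite {β : Type*} [Finite β] (f : β → ℝ) (b : β) : f b ≤ ⨆ b, f b :=
  le_ciSup (Set.finite_range f).bddAbove b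

end Sampling

/-! ### The three sampling regimes -/

section Regimes

variable {n T k : ℕ} {G : WeightedGraph n} (E : G.EigenDecomposition) {Δt : ℝ} {δ ε : ℝ}
  {Ω : Type*} [MeasurableSpace Ω] {μ : Measure Ω} [IsProbabilityMeasure μ]

/-- A sampling operator whose squared norm is the quadratic form of a sum of independent matrices
with mean `1` and a small uniform bound embeds stably. -/
theorem one_sub_le_measureReal_stablyEmbeds (hT : 0 < T) (hk0 : 0 < k) (hk : k ≤ n)
    (hΔt : 0 < Δt) (hδ0 : 0 < δ) (hδ1 : δ < 1) (hε0 : 0 < ε) (hε1 : ε < 1)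
    {J α ρ : Type*} [Fintype J] [Fintype α] [Fintype ρ] [MeasurableSpace α]
    [MeasurableSingletonClass α] {p : J → α → ℝ} {ω : J → Ω → α}
    (hp : ∀ j, IsNondegenerateDistribution (p j)) (hω : IsIndependentSample μ p ω)
    (B : (J → α) → Matrix ρ (SpaceTime T n) ℝ) {X : J → α → Matrix (Fin k) (Fin k) ℝ}
    (hX : ∀ j a, (X j a).IsSymm) (h0 : ∀ j a w, 0 ≤ w ⬝ᵥ X j a *ᵥ w)
    (hXR : ∀ j a w, w ⬝ᵥ X j a *ᵥ w ≤ δ ^ 2 / (3 * Real.log (2 * k / ε)) * (w ⬝ᵥ w))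
    (hM : ∑ j, ∑ a, p j a • X j a = 1)
    (hB : ∀ f w, ‖WithLp.toLp 2 (B f *ᵥ (Utilde E Δt T hk *ᵥ w))‖ ^ 2
      = ∑ j, w ⬝ᵥ X j (f j) *ᵥ w) :
    1 - ε ≤ μ.real {z | StablyEmbeds E Δt hk0 hk δ (B fun j => ω j z)} := by
  have : Nonempty (Fin k) := ⟨⟨0, hk0⟩⟩
  refine (one_sub_le_measureReal_chernoff hp hω hδ0 hδ1 hε0 hε1 hX h0
    (by simpa only [Fintype.card_fin] using hXR) hM).trans (measureReal_mono fun z hz => ?_)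
  refine stablyEmbeds_of_forall E Δt T hk hT hk0 hΔt hδ0 hδ1 fun w => ?_
  rw [hB, ← dotProduct_sum, ← sum_mulVec]
  exact hz w

theorem log_two_mul_div_pos (hk0 : 0 < k) (hε0 : 0 < ε) (hε1 : ε < 1) :
    0 < Real.log (2 * k / ε) := by
  have : (1 : ℝ) ≤ k := by exact_mod_cast hk0
  exact Real.log_pos (by rw [lt_div_iff₀ hε0]; linarith)

theorem Utilde_ne_zero (hT : 0 < T) (hk0 : 0 < k) (hk : k ≤ n) :
    ∃ w : Fin k → ℝ, ∃ s, (Utilde E Δt T hk *ᵥ w) s ≠ 0 := by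
  by_contra! h
  have h1 := sum_nodeGram E Δt T hk hT
  have h2 : (Pi.single ⟨0, hk0⟩ 1 : Fin k → ℝ) ⬝ᵥ
      (∑ s, nodeGram E Δt T hk s) *ᵥ Pi.single ⟨0, hk0⟩ 1 = 0 := by
    rw [sum_mulVec, dotProduct_sum]
    exact Finset.sum_eq_zero fun s _ => by rw [dotProduct_nodeGram, h, sq, zero_mul]
  rw [h1, one_mulVec] at h2
  simp at h2

theorem stablyEmbeds_samplingOp₁ (hT : 0 < T) (hk0 : 0 < k) (hk : k ≤ n)
    (hΔt : 0 < Δt) (hδ0 : 0 < δ) (hδ1 : δ < 1) (hε0 : 0 < ε) (hε1 : ε < 1)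
    {p : Fin n → ℝ} {m : ℕ} {ω : Fin m → Ω → Fin n} (hp : IsNondegenerateDistribution p)
    (hω : IsIndependentSample μ (fun _ => p) ω)
    (hm : 3 / δ ^ 2 * coherence₁ E Δt T hk p ^ 2 * Real.log (2 * k / ε) ≤ m) :
    1 - ε ≤ μ.real {z | StablyEmbeds E Δt hk0 hk δ (samplingOp₁ (T := T) p fun j => ω j z)} := by
  have hL := log_two_mul_div_pos hk0 hε0 hε1
  have hν : ∀ i, 1 / √(p i) * vertexNorm E Δt T hk i ≤ coherence₁ E Δt T hk p := fun i =>
    le_ciSup_of_finite (fun i => 1 / √(p i) * vertexNorm E Δt T hk i) i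
  -- An empty sample would make every vertex norm zero, hence `Utilde` zero, against orthonormality
  -- of its columns.
  have hm0 : (m : ℝ) ≠ 0 := by
    intro h
    obtain ⟨w, ⟨t, i⟩, hne⟩ := Utilde_ne_zero E (Δt := Δt) hT hk0 hk
    have hz := eq_zero_of_sample_size_zero hδ0 hL (vertexNorm_nonneg E Δt T hk i) (hp.1 i) (hν i)
      (h ▸ hm)
    have hle := sum_sq_Utilde_mulVec_le E Δt T hk i w
    rw [hz] at hle
    have := Finset.single_le_sum (f := fun t : Fin T => (Utilde E Δt T hk *ᵥ w) ⟨t, i⟩ ^ 2)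
      (fun _ _ => sq_nonneg _) (Finset.mem_univ t)
    have hpos : 0 < (Utilde E Δt T hk *ᵥ w) ⟨t, i⟩ ^ 2 := by positivity
    linarith
  have hform : ∀ (i : Fin n) (w : Fin k → ℝ),
      w ⬝ᵥ ((1 / (m : ℝ) / p i) • ∑ t : Fin T, nodeGram E Δt T hk ⟨t, i⟩) *ᵥ w
        = 1 / (m : ℝ) / p i * ∑ t : Fin T, (Utilde E Δt T hk *ᵥ w) ⟨t, i⟩ ^ 2 := by
    intro i w
    rw [smul_mulVec, dotProduct_smul, sum_mulVec, dotProduct_sum, smul_eq_mul]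
    simp only [dotProduct_nodeGram]
  have hc : ∀ i, 0 ≤ 1 / (m : ℝ) / p i := fun i => by have := hp.1 i; positivity
  refine one_sub_le_measureReal_stablyEmbeds E hT hk0 hk hΔt hδ0 hδ1 hε0 hε1
    (fun _ => hp) hω (fun f => samplingOp₁ (T := T) p f)
    -- One drawn vertex contributes its nodes at all times at once, so the independent summand is
    -- their total Gram matrix; its size is governed by a spectral norm.
    (X := fun _ i => (1 / (m : ℝ) / p i) • ∑ t : Fin T, nodeGram E Δt T hk ⟨t, i⟩) ?_ ?_ ?_ ?_ ?_
  · exact fun _ i => (isSymm_sum _ fun t => nodeGram_isSymm E Δt T hk _).smul _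
  · intro _ i w
    rw [hform]
    exact mul_nonneg (hc i) (Finset.sum_nonneg fun _ _ => sq_nonneg _)
  · intro _ i w
    rw [hform]
    refine (mul_le_mul_of_nonneg_left (sum_sq_Utilde_mulVec_le E Δt T hk i w) (hc i)).trans ?_
    rw [← mul_assoc]
    exact mul_le_mul_of_nonneg_right (weight_mul_sq_le hδ0 hL (vertexNorm_nonneg E Δt T hk i)
      (hp.1 i) m.cast_nonneg (hν i) hm) (Finset.sum_nonneg fun l _ => mul_self_nonneg (w l))
  · have : ∀ i, p i • (1 / (m : ℝ) / p i) • ∑ t : Fin T, nodeGram E Δt T hk ⟨t, i⟩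
        = (1 / (m : ℝ)) • ∑ t : Fin T, nodeGram E Δt T hk ⟨t, i⟩ := fun i => by
      rw [smul_smul, mul_div_cancel₀ _ (hp.1 i).ne']
    simp only [this]
    rw [Finset.sum_const, ← Finset.smul_sum, Finset.card_univ, Fintype.card_fin,
      ← Nat.cast_smul_eq_nsmul ℝ, smul_smul, mul_one_div_cancel hm0, one_smul, Finset.sum_comm,
      ← Fintype.sum_sigma fun s : SpaceTime T n => nodeGram E Δt T hk s,
      sum_nodeGram E Δt T hk hT]
  · intro f w
    rw [norm_sq_samplingOp₁_mulVec hp.1]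
    refine Finset.sum_congr rfl fun j _ => ?_
    rw [hform, Finset.mul_sum]

theorem stablyEmbeds_samplingOp₂ (hT : 0 < T) (hk0 : 0 < k) (hk : k ≤ n)
    (hΔt : 0 < Δt) (hδ0 : 0 < δ) (hδ1 : δ < 1) (hε0 : 0 < ε) (hε1 : ε < 1)
    {p : Fin T → Fin n → ℝ} {m : Fin T → ℕ} {ω : (Σ t : Fin T, Fin (m t)) → Ω → Fin n}
    (hp : ∀ t, IsNondegenerateDistribution (p t))
    (hω : IsIndependentSample μ (fun s => p s.1) ω)
    (hm : ∀ t, 3 / δ ^ 2 * coherence₂ E Δt T hk p t ^ 2 * Real.log (2 * k / ε) ≤ m t) :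
    1 - ε ≤ μ.real {z | StablyEmbeds E Δt hk0 hk δ (samplingOp₂ p fun s => ω s z)} := by
  have hL := log_two_mul_div_pos hk0 hε0 hε1
  have hν : ∀ t i, 1 / √(p t i) * nodeNorm E Δt T hk ⟨t, i⟩ ≤ coherence₂ E Δt T hk p t :=
    fun t i => le_ciSup_of_finite (fun i => 1 / √(p t i) * nodeNorm E Δt T hk ⟨t, i⟩) i
  have hform : ∀ (t : Fin T) (i : Fin n) (w : Fin k → ℝ),
      w ⬝ᵥ ((1 / (m t : ℝ) / p t i) • nodeGram E Δt T hk ⟨t, i⟩) *ᵥ w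
        = 1 / (m t : ℝ) / p t i * (Utilde E Δt T hk *ᵥ w) ⟨t, i⟩ ^ 2 := by
    intro t i w
    rw [smul_mulVec, dotProduct_smul, dotProduct_nodeGram, smul_eq_mul]
  have hc : ∀ t i, 0 ≤ 1 / (m t : ℝ) / p t i := fun t i => by have := (hp t).1 i; positivity
  refine one_sub_le_measureReal_stablyEmbeds E hT hk0 hk hΔt hδ0 hδ1 hε0 hε1
    (fun r => hp r.1) hω (fun f => samplingOp₂ p f)
    -- The summands are independent but not identically distributed: both law and weight depend on
    -- the time `r.1`. The samples at time `t` have total mean equal to the Gram matrix of that time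
    -- slice.
    (X := fun r i => (1 / (m r.1 : ℝ) / p r.1 i) • nodeGram E Δt T hk ⟨r.1, i⟩) ?_ ?_ ?_ ?_ ?_
  · exact fun _ i => (nodeGram_isSymm E Δt T hk _).smul _
  · intro r i w
    rw [hform]
    exact mul_nonneg (hc _ i) (sq_nonneg _)
  · intro r i w
    rw [hform]
    refine (mul_le_mul_of_nonneg_left (sq_Utilde_mulVec_le E Δt T hk _ w) (hc _ i)).trans ?_
    rw [← mul_assoc]
    exact mul_le_mul_of_nonneg_right (weight_mul_sq_le hδ0 hL (nodeNorm_nonneg E Δt T hk _)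
      ((hp _).1 i) (Nat.cast_nonneg _) (hν _ i) (hm _)) (Finset.sum_nonneg fun l _ => mul_self_nonneg (w l))
  · have : ∀ (t : Fin T) i, p t i • (1 / (m t : ℝ) / p t i) • nodeGram E Δt T hk ⟨t, i⟩
        = (1 / (m t : ℝ)) • nodeGram E Δt T hk ⟨t, i⟩ := fun t i => by
      rw [smul_smul, mul_div_cancel₀ _ ((hp t).1 i).ne']
    simp only [this]
    rw [Fintype.sum_sigma, ← sum_nodeGram E Δt T hk hT, Fintype.sum_sigma]
    refine Finset.sum_congr rfl fun t _ => ?_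
    simp only
    rw [Finset.sum_const, ← Finset.smul_sum, Finset.card_univ, Fintype.card_fin,
      ← Nat.cast_smul_eq_nsmul ℝ, smul_smul]
    -- With no samples at time `t`, the slice's Gram matrices vanish, so nothing is missing from the
    -- mean.
    by_cases hmt : (m t : ℝ) = 0
    · have hz : ∀ i, nodeGram E Δt T hk ⟨t, i⟩ = 0 := by
        intro i
        have h0 := eq_zero_of_sample_size_zero hδ0 hL (nodeNorm_nonneg E Δt T hk _)
          ((hp t).1 i) (hν t i) (hmt ▸ hm t)
        have hsq := nodeNorm_sq E Δt T hk ⟨t, i⟩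
        rw [h0, zero_pow two_ne_zero, eq_comm,
          Finset.sum_eq_zero_iff_of_nonneg fun _ _ => sq_nonneg _] at hsq
        ext l l'
        rw [nodeGram, vecMulVec_apply, pow_eq_zero_iff two_ne_zero |>.1 (hsq l (Finset.mem_univ l)),
          zero_mul, Matrix.zero_apply]
      simp only [hz, Finset.sum_const_zero, smul_zero]
    · rw [mul_one_div_cancel hmt, one_smul]
  · intro f w
    rw [norm_sq_samplingOp₂_mulVec fun t => (hp t).1]
    refine Finset.sum_congr rfl fun r _ => ?_
    rw [hform]

theorem stablyEmbeds_samplingOp₃ (hT : 0 < T) (hk0 : 0 < k) (hk : k ≤ n)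
    (hΔt : 0 < Δt) (hδ0 : 0 < δ) (hδ1 : δ < 1) (hε0 : 0 < ε) (hε1 : ε < 1)
    {p : SpaceTime T n → ℝ} {m : ℕ} {ω : Fin m → Ω → SpaceTime T n}
    (hp : IsNondegenerateDistribution p) (hω : IsIndependentSample μ (fun _ => p) ω)
    (hm : 3 / δ ^ 2 * coherence₃ E Δt T hk p ^ 2 * Real.log (2 * k / ε) ≤ m) :
    1 - ε ≤ μ.real {z | StablyEmbeds E Δt hk0 hk δ (samplingOp₃ p fun j => ω j z)} := by
  have := measurableSingletonClass_spaceTime (n := n) (T := T)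
  have hL := log_two_mul_div_pos hk0 hε0 hε1
  have hν : ∀ s, 1 / √(p s) * nodeNorm E Δt T hk s ≤ coherence₃ E Δt T hk p := fun s =>
    le_ciSup_of_finite (fun s => 1 / √(p s) * nodeNorm E Δt T hk s) s
  have hm0 : (m : ℝ) ≠ 0 := by
    intro h
    obtain ⟨w, s, hne⟩ := Utilde_ne_zero E (Δt := Δt) hT hk0 hk
    have hz := eq_zero_of_sample_size_zero hδ0 hL (nodeNorm_nonneg E Δt T hk s) (hp.1 s) (hν s)
      (h ▸ hm)
    have hle := sq_Utilde_mulVec_le E Δt T hk s w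
    rw [hz] at hle
    have hpos : 0 < (Utilde E Δt T hk *ᵥ w) s ^ 2 := by positivity
    linarith
  have hform : ∀ (s : SpaceTime T n) (w : Fin k → ℝ),
      w ⬝ᵥ ((1 / (m : ℝ) / p s) • nodeGram E Δt T hk s) *ᵥ w
        = 1 / (m : ℝ) / p s * (Utilde E Δt T hk *ᵥ w) s ^ 2 := by
    intro s w
    rw [smul_mulVec, dotProduct_smul, dotProduct_nodeGram, smul_eq_mul]
  have hc : ∀ s, 0 ≤ 1 / (m : ℝ) / p s := fun s => by have := hp.1 s; positivity
  refine one_sub_le_measureReal_stablyEmbeds E hT hk0 hk hΔt hδ0 hδ1 hε0 hε1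
    (fun _ => hp) hω (fun f => samplingOp₃ p f)
    (X := fun _ s => (1 / (m : ℝ) / p s) • nodeGram E Δt T hk s) ?_ ?_ ?_ ?_ ?_
  · exact fun _ s => (nodeGram_isSymm E Δt T hk s).smul _
  · intro _ s w
    rw [hform]
    exact mul_nonneg (hc s) (sq_nonneg _)
  · intro _ s w
    rw [hform]
    refine (mul_le_mul_of_nonneg_left (sq_Utilde_mulVec_le E Δt T hk s w) (hc s)).trans ?_
    rw [← mul_assoc]
    exact mul_le_mul_of_nonneg_right (weight_mul_sq_le hδ0 hL (nodeNorm_nonneg E Δt T hk s)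
      (hp.1 s) m.cast_nonneg (hν s) hm) (Finset.sum_nonneg fun l _ => mul_self_nonneg (w l))
  · have : ∀ s, p s • (1 / (m : ℝ) / p s) • nodeGram E Δt T hk s
        = (1 / (m : ℝ)) • nodeGram E Δt T hk s := fun s => by
      rw [smul_smul, mul_div_cancel₀ _ (hp.1 s).ne']
    simp only [this]
    rw [Finset.sum_const, ← Finset.smul_sum, Finset.card_univ, Fintype.card_fin,
      ← Nat.cast_smul_eq_nsmul ℝ, smul_smul, mul_one_div_cancel hm0, one_smul,
      sum_nodeGram E Δt T hk hT]
  · intro f w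
    rw [norm_sq_samplingOp₃_mulVec hp.1]
    refine Finset.sum_congr rfl fun j _ => ?_
    rw [hform]

end Regimes

end DynSampling

end

theorem mainTheorem1 {n T k : ℕ} (hT : 0 < T) (hk0 : 0 < k) (hk : k ≤ n)
    (G : DynSampling.WeightedGraph n) (E : G.EigenDecomposition) (Δt : ℝ) (hΔt : 0 < Δt)
    (δ ε : ℝ) (hδ0 : 0 < δ) (hδ1 : δ < 1) (hε0 : 0 < ε) (hε1 : ε < 1)
    {Ω : Type*} [MeasurableSpace Ω] (μ : MeasureTheory.Measure Ω)
    [MeasureTheory.IsProbabilityMeasure μ] :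
    -- regime 1
    (∀ (p : Fin n → ℝ) (m : ℕ) (ω : Fin m → Ω → Fin n),
      DynSampling.IsNondegenerateDistribution p →
      DynSampling.IsIndependentSample μ (fun _ => p) ω →
      3 / δ ^ 2 * DynSampling.coherence₁ E Δt T hk p ^ 2 * Real.log (2 * k / ε) ≤ m →
      1 - ε ≤ μ.real {z | DynSampling.StablyEmbeds E Δt hk0 hk δ
        (DynSampling.samplingOp₁ (T := T) p fun j => ω j z)}) ∧
    -- regime 2
    (∀ (p : Fin T → Fin n → ℝ) (m : Fin T → ℕ) (ω : (Σ t : Fin T, Fin (m t)) → Ω → Fin n),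
      (∀ t, DynSampling.IsNondegenerateDistribution (p t)) →
      DynSampling.IsIndependentSample μ (fun s => p s.1) ω →
      (∀ t, 3 / δ ^ 2 * DynSampling.coherence₂ E Δt T hk p t ^ 2 * Real.log (2 * k / ε) ≤ m t) →
      1 - ε ≤ μ.real {z | DynSampling.StablyEmbeds E Δt hk0 hk δ
        (DynSampling.samplingOp₂ p fun s => ω s z)}) ∧
    -- regime 3
    (∀ (p : DynSampling.SpaceTime T n → ℝ) (m : ℕ) (ω : Fin m → Ω → DynSampling.SpaceTime T n),
      DynSampling.IsNondegenerateDistribution p →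
      DynSampling.IsIndependentSample μ (fun _ => p) ω →
      3 / δ ^ 2 * DynSampling.coherence₃ E Δt T hk p ^ 2 * Real.log (2 * k / ε) ≤ m →
      1 - ε ≤ μ.real {z | DynSampling.StablyEmbeds E Δt hk0 hk δ
        (DynSampling.samplingOp₃ p fun j => ω j z)}) :=
  ⟨fun _ _ _ hp hω hm => DynSampling.stablyEmbeds_samplingOp₁ E hT hk0 hk hΔt hδ0 hδ1 hε0 hε1
      hp hω hm,
    fun _ _ _ hp hω hm => DynSampling.stablyEmbeds_samplingOp₂ E hT hk0 hk hΔt hδ0 hδ1 hε0 hε1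
      hp hω hm,
    fun _ _ _ hp hω hm => DynSampling.stablyEmbeds_samplingOp₃ E hT hk0 hk hΔt hδ0 hδ1 hε0 hε1
      hp hω hm⟩
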